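/- For $(e_1,e_2)\in\mathbb C^2$ put $e_3=-(e_1+e_2)$ and let $\mathcal L^{(e_1,e_2)}$ be the complex Lie algebra with basis $V_n$, $n\in\mathbb Z$, and $$[V_n,V_m]=\begin{cases}(m-n)V_{n+m},& n,m\text{ odd},\\ (m-n)\big(V_{n+m}+3e_1V_{n+m-2}+(e_1-e_2)(e_1-e_3)V_{n+m-4}\big),& n,m\text{ even},\\ (m-n)V_{n+m}+(m-n-1)3e_1V_{n+m-2}+(m-n-2)(e_1-e_2)(e_1-e_3)V_{n+m-4},& n\text{ odd},\ m\text{ even}.\end{cases}$$ Let $E_{(e_1,e_2)}$ be the cubic curve $Y^2=f(X)=4(X-e_1)(X-e_2)(X-e_3)$, with marked points $\infty$ and $(e_1,0)$. Let $\mathcal W$ be the Witt algebra, with basis $l_n$, $n\in\mathbb Z$, and $[l_n,l_m]=(m-n)l_{n+m}$. A deformation of $\mathcal W$ over $\mathbb C[t]$ is a Lie $\mathbb C[t]$-algebra structure on $\mathbb C[t]\otimes\mathcal W$ for which the evaluation $t=0$ is a Lie homomorphism onto $\mathcal W$. It is a jump deformation if in some neighbourhood of $0$ the fibres over all $t\neq0$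 are isomorphic to each other but not to the fibre over $0$. Restrict the family to the curve $C=\{e_2=2e_1^2\}$ and use $t=e_1$ as parameter. Write $\mathcal L_t=\mathcal L^{(t,2t^2)}$ and $E_t=E_{(t,2t^2)}$. (1) The restricted family is a deformation of $\mathcal W$ over $\mathbb C[t]$, with fibre $\mathcal L_c$ over $t=c$ ($l_n$ corresponding to $V_n$), $\mathcal L_0\cong\mathcal W$, and bracket $$[V_n,V_m]=\begin{cases}(m-n)V_{n+m},& n,m\text{ odd},\\ (m-n)\big(V_{n+m}+3tV_{n+m-2}+2t^2(1-2t)(1+t)V_{n+m-4}\big),& n,m\text{ even},\\ (m-n)V_{n+m}+(m-n-1)3tV_{n+m-2}+(m-n-2)2t^2(1-2t)(1+t)V_{n+m-4},& n\text{ odd},\ m\text{ even}.\end{cases}$$ (2) $E_t$ is an elliptic curve if and only if $t\notin\{0,\tfrac12,-1,-\tfrac14\}$. In that case $\mathcal L_t$ is isomorphic to the Lie algebra of vector fields on $E_t$ that are regular outside $\{\infty,(t,0)\}$, with $V_{2k+1}=(X-t)^kY\frac{d}{dX}$ and $V_{2k}=\frac12f(X)(X-t)^{k-2}\frac{d}{dX}$,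 and $$j(E_t)=1728\,\frac{(1+2t+4t^2)^3}{(1-2t)^2(1+t)^2(1+4t)^2}.$$ This function of $t$ is not constant on any punctured neighbourhood of $0$. (3) There is $\varepsilon>0$ such that $E_t$ is an elliptic curve for $0<|t|<\varepsilon$ and: - the elliptic curves $E_t$, $0<|t|<\varepsilon$, together with their marked points $\infty$ and $(t,0)$, are pairwise non-isomorphic; without the marked point $(t,0)$, for $0<|s|,|t|<\varepsilon$ one has $E_s\cong E_t$ if and only if $t=s$ or $t=-s/(1+2s)$; - the Lie algebras $\mathcal L_t$, $|t|<\varepsilon$ (including $t=0$), are pairwise non-isomorphic. (4) In particular, this deformation of the Witt algebra is not a jump deformation. -/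

import Mathlib

open scoped TensorProduct LaurentPolynomial Topology

/-! ### Algebras on the free module with basis indexed by the integers -/

/-- The bilinear bracket on the free module with basis `(V_n)`, `n ∈ ℤ`, whose value on
`(V_n, V_m)` is `b n m`. -/
noncomputable def bilinExtend {R : Type*} [CommRing R] (b : ℤ → ℤ → (ℤ →₀ R)) :
    (ℤ →₀ R) →ₗ[R] (ℤ →₀ R) →ₗ[R] (ℤ →₀ R) :=
  Finsupp.linearCombination R (fun n => Finsupp.linearCombination R (b n))

theorem bilinExtend_single {R : Type*} [CommRing R] (b : ℤ → ℤ → (ℤ →₀ R)) (n m : ℤ) (r s : R) :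
    bilinExtend b (Finsupp.single n r) (Finsupp.single m s) = r • s • b n m := by
  simp [bilinExtend]

theorem bilinExtend_self {R : Type*} [CommRing R] (b : ℤ → ℤ → (ℤ →₀ R))
    (h0 : ∀ n, b n n = 0) (h1 : ∀ n m, b n m = -b m n) (x : ℤ →₀ R) :
    bilinExtend b x x = 0 := by
  have hskew : ∀ x y, bilinExtend b x y + bilinExtend b y x = 0 := by
    intro x y
    induction x using Finsupp.induction_linear with
    | zero => simp
    | add f g hf hg =>
      simp only [map_add, LinearMap.add_apply]
      rw [add_add_add_comm, hf, hg, add_zero]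
    | single n r =>
      induction y using Finsupp.induction_linear with
      | zero => simp
      | add f g hf hg =>
        simp only [map_add, LinearMap.add_apply]
        rw [add_add_add_comm, hf, hg, add_zero]
      | single m s =>
        rw [bilinExtend_single, bilinExtend_single, h1 m n]
        module
  induction x using Finsupp.induction_linear with
  | zero => simp
  | add f g hf hg =>
    simp only [map_add, LinearMap.add_apply]
    rw [hf, hg, zero_add, add_zero, hskew]
  | single n r => rw [bilinExtend_single, h0]; simp

theorem bilinExtend_jacobi {R : Type*} [CommRing R] (b : ℤ → ℤ → (ℤ →₀ R))
    (h : ∀ n m k, bilinExtend b (Finsupp.single n 1) (b m k) =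
      bilinExtend b (b n m) (Finsupp.single k 1) + bilinExtend b (Finsupp.single m 1) (b n k))
    (x y z : ℤ →₀ R) :
    bilinExtend b x (bilinExtend b y z) =
      bilinExtend b (bilinExtend b x y) z + bilinExtend b y (bilinExtend b x z) := by
  induction x using Finsupp.induction_linear with
  | zero => simp
  | add f g hf hg => simp only [map_add, LinearMap.add_apply, hf, hg]; abel
  | single n r =>
    induction y using Finsupp.induction_linear with
    | zero => simp
    | add f g hf hg => simp only [map_add, LinearMap.add_apply, hf, hg]; abel
    | single m s =>
      induction z using Finsupp.induction_linear with
      | zero => simp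
      | add f g hf hg => simp only [map_add, hf, hg]; abel
      | single k t =>
        have hs : ∀ (i : ℤ) (c : R), Finsupp.single i c = c • Finsupp.single i (1 : R) := by
          intro i c; rw [Finsupp.smul_single, smul_eq_mul, mul_one]
        rw [hs n r, hs m s, hs k t]
        clear hs
        have e : ∀ i j, bilinExtend b (Finsupp.single i 1) (Finsupp.single j 1) = b i j := by
          intro i j; simp [bilinExtend_single]
        simp only [map_smul, LinearMap.smul_apply, e, h n m k]
        module

/-! ### The Witt algebra -/

/-- `[l_n, l_m] = (m - n) l_{n+m}`. -/
noncomputable def wittBasisBracket (n m : ℤ) : ℤ →₀ ℂ :=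
  ((m - n : ℤ) : ℂ) • Finsupp.single (n + m) 1

/-- The Witt algebra: the complex vector space with basis `l_n`, `n ∈ ℤ`, and
`[l_n, l_m] = (m - n) l_{n+m}`. -/
def WittAlgebra : Type := ℤ →₀ ℂ

namespace WittAlgebra

noncomputable instance : AddCommGroup WittAlgebra := inferInstanceAs (AddCommGroup (ℤ →₀ ℂ))

noncomputable instance : Module ℂ WittAlgebra := inferInstanceAs (Module ℂ (ℤ →₀ ℂ))

/-- The basis element `l_n`. -/
noncomputable def l (n : ℤ) : WittAlgebra := (Finsupp.single n 1 : ℤ →₀ ℂ)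

theorem basis_skew (n m : ℤ) : wittBasisBracket n m = -wittBasisBracket m n := by
  simp only [wittBasisBracket, add_comm m n]
  push_cast
  module

theorem basis_jacobi (n m k : ℤ) :
    bilinExtend wittBasisBracket (Finsupp.single n 1) (wittBasisBracket m k) =
      bilinExtend wittBasisBracket (wittBasisBracket n m) (Finsupp.single k 1) +
      bilinExtend wittBasisBracket (Finsupp.single m 1) (wittBasisBracket n k) := by
  have e : ∀ i j : ℤ, bilinExtend wittBasisBracket (Finsupp.single i 1) (Finsupp.single j 1) =
      ((j - i : ℤ) : ℂ) • Finsupp.single (i + j) 1 := by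
    intro i j; simp [bilinExtend_single, wittBasisBracket]
  simp only [wittBasisBracket, map_smul, LinearMap.smul_apply]
  simp only [e]
  rw [show n + m + k = n + (m + k) by ring, show m + (n + k) = n + (m + k) by ring]
  push_cast
  module

noncomputable instance : LieRing WittAlgebra where
  bracket x y := bilinExtend wittBasisBracket x y
  add_lie x y z := (congrArg (fun f => f z) (map_add (bilinExtend wittBasisBracket) x y))
  lie_add x y z := map_add (bilinExtend wittBasisBracket x) y z
  lie_self x := bilinExtend_self wittBasisBracket (fun n => by simp [wittBasisBracket])
    basis_skew x
  leibniz_lie x y z := bilinExtend_jacobi wittBasisBracket basis_jacobi x y z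

noncomputable instance : LieAlgebra ℂ WittAlgebra where
  lie_smul t x y := map_smul (bilinExtend wittBasisBracket x) t y

end WittAlgebra

/-! ### The two-parameter family of vector field algebras -/

/-- The structure equations of the two-parameter family, over any commutative ring `R` containing
the parameters `e₁`, `e₂`, with `e₃ = -(e₁ + e₂)`. The last case is the skew-symmetric counterpart
of the third. -/
noncomputable def knBasisBracket {R : Type*} [CommRing R] (e₁ e₂ : R) (n m : ℤ) : ℤ →₀ R :=
  let V : ℤ → (ℤ →₀ R) := fun i => Finsupp.single i 1
  let e₃ : R := -(e₁ + e₂)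
  if Odd n then
    if Odd m then ((m - n : ℤ) : R) • V (n + m)
    else
      ((m - n : ℤ) : R) • V (n + m) + (((m - n - 1 : ℤ) : R) * (3 * e₁)) • V (n + m - 2)
        + (((m - n - 2 : ℤ) : R) * ((e₁ - e₂) * (e₁ - e₃))) • V (n + m - 4)
  else
    if Odd m then
      -(((n - m : ℤ) : R) • V (m + n) + (((n - m - 1 : ℤ) : R) * (3 * e₁)) • V (m + n - 2)
        + (((n - m - 2 : ℤ) : R) * ((e₁ - e₂) * (e₁ - e₃))) • V (m + n - 4))
    else
      ((m - n : ℤ) : R) • (V (n + m) + (3 * e₁) • V (n + m - 2)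
        + ((e₁ - e₂) * (e₁ - e₃)) • V (n + m - 4))

theorem knBasisBracket_skew {R : Type*} [CommRing R] (e₁ e₂ : R) (n m : ℤ) :
    knBasisBracket e₁ e₂ n m = -knBasisBracket e₁ e₂ m n := by
  simp only [knBasisBracket]
  by_cases hn : Odd n <;> by_cases hm : Odd m <;> simp only [hn, hm, if_true, if_false]
  · rw [add_comm m n]; push_cast; module
  · rw [neg_neg]
  · rw [add_comm m n]; push_cast; module

theorem knBasisBracket_self {R : Type*} [CommRing R] (e₁ e₂ : R) (n : ℤ) :
    knBasisBracket e₁ e₂ n n = 0 := by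
  simp only [knBasisBracket]
  by_cases hn : Odd n <;> simp [hn]

theorem knBasisBracket_jacobi {R : Type*} [CommRing R] (e₁ e₂ : R) (n m k : ℤ) :
    bilinExtend (knBasisBracket e₁ e₂) (Finsupp.single n 1) (knBasisBracket e₁ e₂ m k) =
      bilinExtend (knBasisBracket e₁ e₂) (knBasisBracket e₁ e₂ n m) (Finsupp.single k 1) +
      bilinExtend (knBasisBracket e₁ e₂) (Finsupp.single m 1) (knBasisBracket e₁ e₂ n k) := by
  have e : ∀ i j : ℤ, bilinExtend (knBasisBracket e₁ e₂) (Finsupp.single i 1)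
      (Finsupp.single j 1) = knBasisBracket e₁ e₂ i j := by
    intro i j; simp [bilinExtend_single]
  have h2 : ∀ i : ℤ, Odd (i - 2) ↔ Odd i := by intro i; simp
  have h4 : ∀ i : ℤ, Odd (i - 4) ↔ Odd i := by
    intro i; simp [Int.odd_sub, show Even (4 : ℤ) by decide]
  by_cases hn : Odd n <;> by_cases hm : Odd m <;> by_cases hk : Odd k <;>
  · rw [knBasisBracket, knBasisBracket, knBasisBracket]
    simp only [hn, hm, hk, if_true, if_false, map_smul, map_add, map_neg, LinearMap.smul_apply,
      LinearMap.add_apply, LinearMap.neg_apply, e]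
    simp only [knBasisBracket, hn, hm, hk, h2, h4, Int.odd_add, ← Int.not_odd_iff_even,
      if_true, if_false, not_true, not_false_iff, iff_true, iff_false]
    push_cast
    ring_nf
    module

/-- The Lie algebra `𝓛^(e₁, e₂)` over `R`: the free `R`-module with basis `V_n`, `n ∈ ℤ`, and the
structure equations above. -/
def KNAlgebra {R : Type*} [CommRing R] (_e₁ _e₂ : R) : Type _ := ℤ →₀ R

namespace KNAlgebra

variable {R : Type*} [CommRing R] (e₁ e₂ : R)

noncomputable instance : AddCommGroup (KNAlgebra e₁ e₂) := inferInstanceAs (AddCommGroup (ℤ →₀ R))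

noncomputable instance : Module R (KNAlgebra e₁ e₂) := inferInstanceAs (Module R (ℤ →₀ R))

/-- The basis element `V_n`. -/
noncomputable def V (n : ℤ) : KNAlgebra e₁ e₂ := (Finsupp.single n 1 : ℤ →₀ R)

noncomputable instance : LieRing (KNAlgebra e₁ e₂) where
  bracket x y := bilinExtend (knBasisBracket e₁ e₂) x y
  add_lie x y z := (congrArg (fun f => f z) (map_add (bilinExtend (knBasisBracket e₁ e₂)) x y))
  lie_add x y z := map_add (bilinExtend (knBasisBracket e₁ e₂) x) y z
  lie_self x := bilinExtend_self _ (knBasisBracket_self e₁ e₂) (knBasisBracket_skew e₁ e₂) x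
  leibniz_lie x y z := bilinExtend_jacobi _ (knBasisBracket_jacobi e₁ e₂) x y z

noncomputable instance : LieAlgebra R (KNAlgebra e₁ e₂) where
  lie_smul t x y := map_smul (bilinExtend (knBasisBracket e₁ e₂) x) t y

end KNAlgebra

/-! ### Deformations of a Lie algebra -/

section Deformation

variable {K : Type*} [Field K] {A : Type*} [CommRing A] [Algebra K A]

/-- `η ⊗ id : A ⊗ L → K ⊗ L = L`. -/
noncomputable def specialize (η : A →ₐ[K] K) (L : Type*) [AddCommGroup L] [Module K L] :
    A ⊗[K] L →ₗ[K] L :=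
  (TensorProduct.lid K L).toLinearMap ∘ₗ η.toLinearMap.rTensor L

theorem specialize_tmul (η : A →ₐ[K] K) (L : Type*) [AddCommGroup L] [Module K L] (a : A) (x : L) :
    specialize η L (a ⊗ₜ x) = η a • x := by
  simp [specialize]

/-- A deformation of the Lie algebra `L` with base `A` and augmentation `ε : A → K`: a Lie
`A`-algebra structure on `A ⊗ L` such that `ε ⊗ id : A ⊗ L → L` is a homomorphism of Lie
algebras. -/
structure LieDeformation (ε : A →ₐ[K] K) (L : Type*) [LieRing L] [LieAlgebra K L] where
  /-- The `A`-bilinear bracket on `A ⊗ L`. -/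
  br : A ⊗[K] L →ₗ[A] A ⊗[K] L →ₗ[A] A ⊗[K] L
  alternating : ∀ u, br u u = 0
  jacobi : ∀ u v w, br u (br v w) = br (br u v) w + br v (br u w)
  specialize_br : ∀ u v, specialize ε L (br u v) = ⁅specialize ε L u, specialize ε L v⁆

namespace LieDeformation

variable {ε : A →ₐ[K] K} {L : Type*} [LieRing L] [LieAlgebra K L]

/-- The bracket `(x, y) ↦ (η ⊗ id)[1 ⊗ x, 1 ⊗ y]` on `L` at the point `η` of the base. -/
noncomputable def fibreBracket (D : LieDeformation ε L) (η : A →ₐ[K] K) : L →ₗ[K] L →ₗ[K] L :=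
  LinearMap.mk₂ K (fun x y => specialize η L (D.br (1 ⊗ₜ x) (1 ⊗ₜ y)))
    (fun x y z => by simp [TensorProduct.tmul_add])
    (fun c x y => by
      have h : (1 : A) ⊗ₜ[K] (c • x) = algebraMap K A c • ((1 : A) ⊗ₜ[K] x) := by
        rw [TensorProduct.tmul_smul, algebraMap_smul]
      rw [h, map_smul, LinearMap.smul_apply, algebraMap_smul, map_smul])
    (fun x y z => by simp [TensorProduct.tmul_add])
    (fun c x y => by
      have h : (1 : A) ⊗ₜ[K] (c • y) = algebraMap K A c • ((1 : A) ⊗ₜ[K] y) := by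
        rw [TensorProduct.tmul_smul, algebraMap_smul]
      rw [h, map_smul, algebraMap_smul, map_smul])

theorem specialize_smul (η : A →ₐ[K] K) (a : A) (u : A ⊗[K] L) :
    specialize η L (a • u) = η a • specialize η L u := by
  induction u with
  | zero => simp
  | add u v hu hv => simp [hu, hv]
  | tmul b x => rw [TensorProduct.smul_tmul', specialize_tmul, specialize_tmul, smul_eq_mul,
      map_mul, mul_smul]

theorem specialize_br_eq (D : LieDeformation ε L) (η : A →ₐ[K] K) (u v : A ⊗[K] L) :
    specialize η L (D.br u v) = D.fibreBracket η (specialize η L u) (specialize η L v) := by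
  have ht : ∀ (b : A) (z : L), b ⊗ₜ[K] z = b • ((1 : A) ⊗ₜ[K] z) := by
    intro b z; rw [TensorProduct.smul_tmul', smul_eq_mul, mul_one]
  induction u with
  | zero => simp
  | add u u' hu hu' => simp [hu, hu']
  | tmul a x =>
    induction v with
    | zero => simp
    | add v v' hv hv' => simp only [map_add, hv, hv']
    | tmul b y =>
      rw [ht a x, ht b y]
      simp only [map_smul, LinearMap.smul_apply, specialize_smul, specialize_tmul, map_one,
        one_smul]
      rfl

theorem fibreBracket_jacobi (D : LieDeformation ε L) (η : A →ₐ[K] K) (x y z : L) :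
    D.fibreBracket η x (D.fibreBracket η y z) =
      D.fibreBracket η (D.fibreBracket η x y) z + D.fibreBracket η y (D.fibreBracket η x z) := by
  have h1 : ∀ w : L, specialize η L ((1 : A) ⊗ₜ w) = w := fun w => by simp [specialize_tmul]
  have h := congrArg (specialize η L) (D.jacobi (1 ⊗ₜ x) (1 ⊗ₜ y) (1 ⊗ₜ z))
  simpa only [map_add, specialize_br_eq, h1] using h

/-- The fibre of a deformation at the point `η` of the base: the vector space `L` with the bracket
specialized at `η`. -/
def Fibre (_D : LieDeformation ε L) (_η : A →ₐ[K] K) : Type _ := L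

variable (D : LieDeformation ε L) (η : A →ₐ[K] K)

noncomputable instance : AddCommGroup (D.Fibre η) := inferInstanceAs (AddCommGroup L)

noncomputable instance : Module K (D.Fibre η) := inferInstanceAs (Module K L)

/-- The element of the fibre given by `x ∈ L`. -/
def toFibre (x : L) : D.Fibre η := x

noncomputable instance : LieRing (D.Fibre η) where
  bracket x y := D.fibreBracket η x y
  add_lie x y z := congrArg (fun f => f z) (map_add (D.fibreBracket η) x y)
  lie_add x y z := map_add (D.fibreBracket η x) y z
  lie_self x := by
    change specialize η L (D.br (1 ⊗ₜ x) (1 ⊗ₜ x)) = 0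
    rw [D.alternating, map_zero]
  leibniz_lie x y z := D.fibreBracket_jacobi η x y z

noncomputable instance : LieAlgebra K (D.Fibre η) where
  lie_smul t x y := map_smul (D.fibreBracket η x) t y

end LieDeformation

/-- The Lie algebra `𝓛_t` of a one-parameter geometric deformation (base `ℂ[t]`, augmentation
`t ↦ 0`) at the parameter value `c`. -/
abbrev LieDeformation.at {L : Type*} [LieRing L] [LieAlgebra ℂ L]
    (D : LieDeformation (Polynomial.aeval (0 : ℂ)) L) (c : ℂ) : Type _ :=
  D.Fibre (Polynomial.aeval c)

/-- A one-parameter deformation is a jump deformation if, near `0`, the algebras at all non-zero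
parameter values are isomorphic to each other, but not to the algebra at `0`. -/
def LieDeformation.IsJump {L : Type*} [LieRing L] [LieAlgebra ℂ L]
    (D : LieDeformation (Polynomial.aeval (0 : ℂ)) L) : Prop :=
  ∃ U ∈ 𝓝 (0 : ℂ), ∀ s ∈ U, s ≠ 0 →
    (∀ t ∈ U, t ≠ 0 → Nonempty (D.at s ≃ₗ⁅ℂ⁆ D.at t)) ∧ IsEmpty (D.at s ≃ₗ⁅ℂ⁆ D.at 0)

end Deformation

/-! ### The family over the curve `e₂ = 2 e₁²` -/

section CurveFamily

open Polynomial

/-- The identification of `ℂ[t] ⊗ W` with the free `ℂ[t]`-module with basis `V_n`, `n ∈ ℤ`, sending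
`1 ⊗ l_n` to `V_n`. -/
noncomputable def familyEquiv : ℂ[X] ⊗[ℂ] WittAlgebra ≃ₗ[ℂ[X]] (ℤ →₀ ℂ[X]) :=
  TensorProduct.finsuppScalarRight ℂ ℂ[X] ℂ[X] ℤ

theorem familyEquiv_symm_single (i : ℤ) (a : ℂ[X]) :
    familyEquiv.symm (Finsupp.single i a) = a ⊗ₜ WittAlgebra.l i :=
  TensorProduct.finsuppScalarRight_symm_apply_single (R := ℂ) (S := ℂ[X]) i a

/-- The `ℂ[t]`-bilinear bracket on `ℂ[t] ⊗ W` obtained from `𝓛^(e₁, e₂)`, for polynomials `e₁`, `e₂`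
in `t`, through the identification `1 ⊗ l_n ↔ V_n`. -/
noncomputable def familyBracket (e₁ e₂ : ℂ[X]) :
    ℂ[X] ⊗[ℂ] WittAlgebra →ₗ[ℂ[X]] ℂ[X] ⊗[ℂ] WittAlgebra →ₗ[ℂ[X]] ℂ[X] ⊗[ℂ] WittAlgebra :=
  ((bilinExtend (knBasisBracket e₁ e₂)).compl₁₂ familyEquiv.toLinearMap
    familyEquiv.toLinearMap).compr₂ familyEquiv.symm.toLinearMap

theorem familyBracket_apply (e₁ e₂ : ℂ[X]) (u v : ℂ[X] ⊗[ℂ] WittAlgebra) :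
    familyBracket e₁ e₂ u v =
      familyEquiv.symm (bilinExtend (knBasisBracket e₁ e₂) (familyEquiv u) (familyEquiv v)) :=
  rfl

theorem WittAlgebra.l_lie_l (n m : ℤ) :
    ⁅WittAlgebra.l n, WittAlgebra.l m⁆ = ((m - n : ℤ) : ℂ) • WittAlgebra.l (n + m) := by
  change bilinExtend wittBasisBracket (Finsupp.single n 1) (Finsupp.single m 1) = _
  rw [bilinExtend_single, one_smul, one_smul]
  rfl

theorem specialize_knBasisBracket (e₁ e₂ : ℂ[X]) (h₁ : aeval (0 : ℂ) e₁ = 0)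
    (h₂ : aeval (0 : ℂ) e₂ = 0) (n m : ℤ) :
    specialize (aeval (0 : ℂ)) WittAlgebra (familyEquiv.symm (knBasisBracket e₁ e₂ n m)) =
      ⁅WittAlgebra.l n, WittAlgebra.l m⁆ := by
  rw [WittAlgebra.l_lie_l, knBasisBracket]
  split_ifs <;>
  · simp only [map_add, map_neg, map_smul, familyEquiv_symm_single,
      LieDeformation.specialize_smul, specialize_tmul, map_mul, map_sub, map_intCast, h₁, h₂,
      map_one, one_smul, mul_zero, zero_mul, zero_smul, add_zero, sub_zero, add_comm m n]
    try (push_cast; module)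

theorem specialize_familyBracket (e₁ e₂ : ℂ[X]) (h₁ : aeval (0 : ℂ) e₁ = 0)
    (h₂ : aeval (0 : ℂ) e₂ = 0) (u v : ℂ[X] ⊗[ℂ] WittAlgebra) :
    specialize (aeval (0 : ℂ)) WittAlgebra (familyBracket e₁ e₂ u v) =
      ⁅specialize (aeval (0 : ℂ)) WittAlgebra u, specialize (aeval (0 : ℂ)) WittAlgebra v⁆ := by
  obtain ⟨x, rfl⟩ := familyEquiv.symm.surjective u
  obtain ⟨y, rfl⟩ := familyEquiv.symm.surjective v
  rw [familyBracket_apply, LinearEquiv.apply_symm_apply, LinearEquiv.apply_symm_apply]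
  induction x using Finsupp.induction_linear with
  | zero => simp
  | add f g hf hg => simp only [map_add, LinearMap.add_apply, add_lie, hf, hg]
  | single n r =>
    induction y using Finsupp.induction_linear with
    | zero => simp
    | add f g hf hg => simp only [map_add, lie_add, hf, hg]
    | single m t =>
      rw [bilinExtend_single, familyEquiv_symm_single, familyEquiv_symm_single,
        LinearEquiv.map_smul, LinearEquiv.map_smul, LieDeformation.specialize_smul, LieDeformation.specialize_smul,
        specialize_knBasisBracket e₁ e₂ h₁ h₂, specialize_tmul, specialize_tmul, smul_lie, lie_smul]

/-- The deformation of the Witt algebra over the affine line with parameter `t` obtained by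
restricting the family `𝓛^(e₁, e₂)` to the parametrized curve `e₁ = t`, `e₂ = 2 t²`. -/
noncomputable def curveDeformation : LieDeformation (aeval (R := ℂ) (0 : ℂ)) WittAlgebra where
  br := familyBracket X (2 * X ^ 2)
  alternating u := by
    rw [familyBracket_apply, bilinExtend_self _ (knBasisBracket_self _ _)
      (knBasisBracket_skew _ _), map_zero]
  jacobi u v w := by
    simp only [familyBracket_apply, LinearEquiv.apply_symm_apply]
    rw [bilinExtend_jacobi _ (knBasisBracket_jacobi _ _), map_add]
  specialize_br u v := specialize_familyBracket _ _ (by simp) (by simp) u v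

end CurveFamily

/-! ### Elliptic curves and vector fields -/

/-- The cubic curve `Y² = 4 (X - e₁)(X - e₂)(X - e₃)`, `e₃ = -(e₁ + e₂)`, written as a Weierstrass
curve `y² = (X - e₁)(X - e₂)(X - e₃)` by `Y = 2 y`. -/
def cubicCurve (e₁ e₂ : ℂ) : WeierstrassCurve ℂ :=
  let e₃ := -(e₁ + e₂)
  { a₁ := 0, a₂ := 0, a₃ := 0, a₄ := e₁ * e₂ + e₁ * e₃ + e₂ * e₃, a₆ := -(e₁ * e₂ * e₃) }

/-- There is an isomorphism of the curves with parameters `(e₁, e₂)` and `(e₁', e₂')`, given by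
`(x, y) = (u² x' + r, u³ y' + u² s x' + t)`, that carries the point at infinity to the point at
infinity and the marked point `(e₁', 0)` to the marked point `(e₁, 0)`. -/
def TwoPointedIso (e₁ e₂ e₁' e₂' : ℂ) : Prop :=
  ∃ C : WeierstrassCurve.VariableChange ℂ, C • cubicCurve e₁ e₂ = cubicCurve e₁' e₂' ∧
    (C.u : ℂ) ^ 2 * e₁' + C.r = e₁ ∧ (C.u : ℂ) ^ 2 * C.s * e₁' + C.t = 0

namespace PuncturedCurve

/-- The function `X = (X - e₁) + e₁` in `ℂ[X, (X - e₁)⁻¹]`, the ring of Laurent polynomials in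
`T = X - e₁`. -/
noncomputable def xCoord (e₁ : ℂ) : ℂ[T;T⁻¹] := LaurentPolynomial.T 1 + LaurentPolynomial.C e₁

/-- `f(X) = 4 (X - e₁)(X - e₂)(X - e₃)`. -/
noncomputable def cubic (e₁ e₂ : ℂ) : ℂ[T;T⁻¹] :=
  let e₃ := -(e₁ + e₂)
  4 * (xCoord e₁ - LaurentPolynomial.C e₁) * (xCoord e₁ - LaurentPolynomial.C e₂)
    * (xCoord e₁ - LaurentPolynomial.C e₃)

/-- The algebra of functions `ℂ[X, (X - e₁)⁻¹][Y] / (Y² - f(X))` on the cubic curve that are regular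
outside the points `∞` and `(e₁, 0)`. -/
abbrev FunctionAlgebra (e₁ e₂ : ℂ) : Type :=
  AdjoinRoot ((Polynomial.X : Polynomial ℂ[T;T⁻¹]) ^ 2 - Polynomial.C (cubic e₁ e₂))

/-- The Lie algebra of vector fields on the curve that are regular outside `∞` and `(e₁, 0)`. -/
abbrev VectorFields (e₁ e₂ : ℂ) : Type :=
  Derivation ℂ (FunctionAlgebra e₁ e₂) (FunctionAlgebra e₁ e₂)

/-- A function of `X` alone, as a function on the curve. -/
noncomputable abbrev ofX (e₁ e₂ : ℂ) : ℂ[T;T⁻¹] →+* FunctionAlgebra e₁ e₂ :=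
  AdjoinRoot.of ((Polynomial.X : Polynomial ℂ[T;T⁻¹]) ^ 2 - Polynomial.C (cubic e₁ e₂))

/-- The function `Y` on the curve. -/
noncomputable abbrev Y (e₁ e₂ : ℂ) : FunctionAlgebra e₁ e₂ :=
  AdjoinRoot.root ((Polynomial.X : Polynomial ℂ[T;T⁻¹]) ^ 2 - Polynomial.C (cubic e₁ e₂))

end PuncturedCurve

/-- The rational function giving the `j`-invariant along the curve `e₂ = 2 e₁²`. -/
noncomputable def jAlongCurve (c : ℂ) : ℂ :=
  1728 * ((1 + 2 * c + 4 * c ^ 2) ^ 3 / ((1 - 2 * c) ^ 2 * (1 + c) ^ 2 * (1 + 4 * c) ^ 2))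

/-!
For every `(e₁, e₂)`, smooth cubic or not, let `A` be the algebra of functions on the cubic that are
regular outside `∞` and `(e₁, 0)`, and let `D = Y d/dX`. Sending `V_{2k+1}` to `(X - e₁) ^ k` and
`V_{2k}` to `Y (X - e₁) ^ (k - 2) / 2` identifies `𝓛^(e₁, e₂)` with `A` under the Wronskian bracket
`[f, g] = f D g - g D f` (`PuncturedCurve.toFunction_lie`). If the cubic is smooth, then
`Der A = A D`, because `X - e₁` is invertible and the other two roots are distinct
(`PuncturedCurve.exists_eq_smul_invariantField`); this gives the vector field description.

The algebras `𝓛_t` are told apart by recovering `A` from the Lie algebra. A linear map `h` with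
`2 h [f, g] = [h f, g] + [f, h g]` is called a half-derivation here. Multiplication by an element of
`A` is one, and on a domain of characteristic zero with `D ≠ 0` there are no others
(`halfDerivation_eq_mul`): after subtracting multiplication by `h 1`, the identity with `f = 1` says
`D (h g) = 2 h (D g)`, the Jacobi identity gives `[h g, D k] = [h k, D g]`, so that `h` is a second
order differential operator over the fraction field, and the two relations together kill its
coefficients. Since half-derivations are defined by the bracket alone, an isomorphism of Lie
algebras induces one of the function algebras (`nonempty_algEquiv_of_wronskian_equiv`).

In terms of `T = X - e₁` the cubic is `4 T (T² + 3 e₁ T + b)`. If `b ≠ 0`, then the two terms of a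
norm `p² - q² Y²` have degrees of different parity at both ends, and so all units of `A` are of the
form `c T ^ n` (`PuncturedCurve.exists_eq_of_isUnit`). An isomorphism therefore sends `T` to
`c T'^{±1}`, and comparing the equations shows that `e₁² b' = e₁'² b`
(`PuncturedCurve.sq_mul_quadCoeff_eq`). Along `e₂ = 2 e₁²` one has `b / e₁² = 2 (1 - 2 t) (1 + t)`,
which is injective near `t = 0`. At `t = 0` the function `Y` is a unit as well, which separates the
Witt algebra from the others (`PuncturedCurve.isEmpty_algEquiv_zero`).

The statements on elliptic curves come from the invariants `c₄`, `c₆` and `Δ`. Equality of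
`j`-invariants at `s` and `t` factors as
`(s - t) (1 + 2 (s + t)) (s + t + 2 s t) (1 + 2 s + 4 s t) (1 + 2 t + 4 s t) (1 - 4 s t) = 0`,
and only the first and the third factor can vanish near `0`.
-/

/-! ### Half-derivations of Wronskian brackets -/

section Wronskian

variable {A : Type*} [CommRing A]

/-- The Wronskian bracket `f g' - g f'`, which is the bracket of the vector fields `f D` and
`g D`. -/
def wronskian (D : A → A) (f g : A) : A := f * D g - g * D f

variable [IsDomain A] [CharZero A] {R : Type*} [CommRing R] [Algebra R A] (D : Derivation R A A)

/-- The coefficients of a differential operator are detected by its values on `u`, `u²`, `u³`, for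
any `u` that is not a constant. -/
theorem coeff_eq_zero_of_diffOp_eq_zero {u : A} (hu : D u ≠ 0) (c₃ c₂ c₁ : A)
    (h : ∀ g, c₃ * D (D (D g)) + c₂ * D (D g) + c₁ * D g = 0) :
    c₃ = 0 ∧ c₂ = 0 ∧ c₁ = 0 := by
  have h1 := h u
  have h2 := h (u * u)
  have h3 := h (u * (u * u))
  simp only [Derivation.leibniz, smul_eq_mul, map_add] at h1 h2 h3
  have e3 : (6 * D u ^ 3) * c₃ = 0 := by
    linear_combination h3 - 3 * u * h2 + 3 * u ^ 2 * h1
  have hc3 : c₃ = 0 := by simpa [hu] using e3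
  subst hc3
  have e2 : (2 * D u ^ 2) * c₂ = 0 := by
    linear_combination h2 - 2 * u * h1
  have hc2 : c₂ = 0 := by simpa [hu] using e2
  subst hc2
  refine ⟨rfl, rfl, ?_⟩
  simpa [hu] using h1

/-- A half-derivation `h` of the Wronskian bracket that kills `1` vanishes: the Jacobi identity
makes it a second order differential operator over the fraction field, and the relation
`(h g)' = 2 h(g')` then kills its coefficients. -/
theorem halfDerivation_eq_zero (hD : D ≠ 0) (h : A →+ A) (h1 : h 1 = 0)
    (hh : ∀ f g, 2 * h (wronskian D f g) = wronskian D (h f) g + wronskian D f (h g)) (g : A) :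
    h g = 0 := by
  obtain ⟨u, hu⟩ : ∃ u, D u ≠ 0 := by
    by_contra! hc
    exact hD (Derivation.ext hc)
  have hd : ∀ g, D (h g) = 2 * h (D g) := by
    intro g
    have := hh 1 g
    simp only [wronskian, h1, Derivation.map_one_eq_zero, one_mul, mul_zero, sub_zero, zero_mul,
      map_zero, zero_add] at this
    exact this.symm
  have hD2 : D (2 : A) = 0 := by simpa using D.map_natCast 2
  -- Applying `D = [1, ·]` to the defining identity and comparing with the identity for
  -- `[g', k] + [g, k']` eliminates the values of `h` on brackets.
  have key : ∀ g k, wronskian D (h g) (D k) = wronskian D (h k) (D g) := by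
    intro g k
    have e' := congrArg D (hh g k)
    have e1 := hd (wronskian D g k)
    have e2 := hh (D g) k
    have e3 := hh g (D k)
    have e4 : wronskian D (D g) k + wronskian D g (D k) = D (wronskian D g k) := by
      simp only [wronskian, map_sub, Derivation.leibniz, smul_eq_mul]; ring
    have e5 := congrArg h e4
    rw [map_add] at e5
    rw [D.leibniz, hD2, smul_zero, add_zero, smul_eq_mul, e1, ← e5] at e'
    generalize h (wronskian D (D g) k) = P at *
    generalize h (wronskian D g (D k)) = Q at *
    simp only [wronskian, map_sub, map_add, Derivation.leibniz, smul_eq_mul, hd, hD2] at e' e2 e3 ⊢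
    linear_combination e' - 2 * e2 - 2 * e3
  -- Eliminating `h(g)'` between the cases `k = u` and `k = u²`.
  have formula : ∀ g, 2 * D u ^ 2 * h g =
      (h (u * u) - 2 * u * h u) * D (D g) - (D (h (u * u)) - 2 * u * D (h u)) * D g := by
    intro g
    have k1 := key g u
    have k2 := key g (u * u)
    simp only [wronskian, Derivation.leibniz, smul_eq_mul, map_add] at k1 k2
    linear_combination k2 - 2 * u * k1
  generalize h (u * u) - 2 * u * h u = α at formula
  generalize D (h (u * u)) - 2 * u * D (h u) = β at formula
  set N := 2 * D u ^ 2 with hN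
  have hN0 : N ≠ 0 := by simp [hN, hu]
  -- Differentiating `formula` and comparing with `formula` at `g'`, since `h(g)' = 2 h(g')`.
  have formula' : ∀ g, (N * α) * D (D (D g)) + (-N * β - N * D α + D N * α) * D (D g)
      + (N * D β - D N * β) * D g = 0 := by
    intro g
    have f1 := formula g
    have f2 := formula (D g)
    have f3 := congrArg D f1
    simp only [map_sub, Derivation.leibniz, smul_eq_mul, hd] at f3
    linear_combination N * f3 - 2 * N * f2 - D N * f1
  obtain ⟨hα, hβ, -⟩ := coeff_eq_zero_of_diffOp_eq_zero D hu _ _ _ formula'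
  have hα : α = 0 := by simpa [hN0] using hα
  subst hα
  have hβ : β = 0 := by simpa [hN0] using hβ
  subst hβ
  simpa [hN0] using formula g

/-- The half-derivations of the Wronskian bracket are the multiplication operators. -/
theorem halfDerivation_eq_mul (hD : D ≠ 0) (h : A →+ A)
    (hh : ∀ f g, 2 * h (wronskian D f g) = wronskian D (h f) g + wronskian D f (h g)) (g : A) :
    h g = h 1 * g := by
  have := halfDerivation_eq_zero D hD (h - AddMonoidHom.mulLeft (h 1)) (by simp) (by
    intro f g
    have := hh f g
    simp only [AddMonoidHom.sub_apply, AddMonoidHom.coe_mulLeft]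
    generalize h (wronskian D f g) = P at *
    simp only [wronskian, map_sub, Derivation.leibniz, smul_eq_mul] at *
    linear_combination this) g
  simpa [sub_eq_zero] using this

end Wronskian

/-- An isomorphism of Wronskian brackets conjugates multiplication operators into multiplication
operators, because it preserves half-derivations. -/
theorem conj_mul_eq_mul {R A B : Type*} [CommRing R] [CommRing A] [Algebra R A] [CommRing B]
    [IsDomain B] [CharZero B] [Algebra R B] (D : Derivation R A A)
    {D' : Derivation R B B} (hD' : D' ≠ 0) (φ : A ≃ₗ[R] B)
    (hφ : ∀ f g, φ (wronskian D f g) = wronskian D' (φ f) (φ g)) (a : A) (y : B) :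
    φ (a * φ.symm y) = φ (a * φ.symm 1) * y := by
  have hφ' : ∀ f g, φ.symm (wronskian D' f g) = wronskian D (φ.symm f) (φ.symm g) := by
    intro f g; rw [LinearEquiv.symm_apply_eq, hφ]; simp
  have mulw : ∀ f g : A, a * wronskian D f g + a * wronskian D f g =
      wronskian D (a * f) g + wronskian D f (a * g) := by
    intro f g; simp only [wronskian, Derivation.leibniz, smul_eq_mul]; ring
  refine halfDerivation_eq_mul D' hD'
    (φ.toLinearMap.toAddMonoidHom.comp
      ((AddMonoidHom.mulLeft a).comp φ.symm.toLinearMap.toAddMonoidHom)) (fun f g => ?_) y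
  change 2 * φ (a * φ.symm _) =
    wronskian D' (φ (a * φ.symm _)) _ + wronskian D' _ (φ (a * φ.symm _))
  have e := congrArg φ (mulw (φ.symm f) (φ.symm g))
  rw [map_add, map_add, hφ, hφ] at e
  simp only [LinearEquiv.apply_symm_apply] at e
  rw [hφ', two_mul, e]

/-- A Wronskian Lie algebra determines the underlying commutative algebra. -/
theorem nonempty_algEquiv_of_wronskian_equiv {R A B : Type*} [CommRing R]
    [CommRing A] [IsDomain A] [CharZero A] [Algebra R A]
    [CommRing B] [IsDomain B] [CharZero B] [Algebra R B] {D : Derivation R A A} (hD : D ≠ 0)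
    {D' : Derivation R B B} (hD' : D' ≠ 0) (φ : A ≃ₗ[R] B)
    (hφ : ∀ f g, φ (wronskian D f g) = wronskian D' (φ f) (φ g)) : Nonempty (A ≃ₐ[R] B) := by
  have hφ' : ∀ f g, φ.symm (wronskian D' f g) = wronskian D (φ.symm f) (φ.symm g) := by
    intro f g; rw [LinearEquiv.symm_apply_eq, hφ]; simp
  have m1 := conj_mul_eq_mul D hD' φ hφ
  have m2 := conj_mul_eq_mul D' hD φ.symm hφ'
  let ψ : A →ₐ[R] B := AlgHom.ofLinearMap
    (φ.toLinearMap ∘ₗ (LinearMap.mulRight R (φ.symm 1))) (by simp) (fun a b => by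
      have := m1 a (φ (b * φ.symm 1))
      simpa [mul_assoc] using this)
  have hψ : ∀ a, ψ a = φ (a * φ.symm 1) := fun a => rfl
  refine ⟨AlgEquiv.ofBijective ψ ⟨?_, fun b => ⟨φ.symm (b * φ 1), ?_⟩⟩⟩
  · refine (injective_iff_map_eq_zero ψ).2 fun a ha => ?_
    simpa [← hψ, ha] using m1 a (φ 1)
  · have := m2 b (φ.symm 1)
    simp only [LinearEquiv.symm_symm, LinearEquiv.apply_symm_apply, mul_one] at this
    rw [hψ, ← this, LinearEquiv.apply_symm_apply]

/-! ### Quadratic extensions -/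

namespace QuadraticExtension

open Polynomial

variable {R : Type*} [CommRing R] {f : R}

theorem root_sq : AdjoinRoot.root (X ^ 2 - C f) ^ 2 = AdjoinRoot.of (X ^ 2 - C f) f := by
  have := AdjoinRoot.eval₂_root (X ^ 2 - C f)
  simpa [sub_eq_zero] using this

theorem exists_eq_add_mul_root (x : AdjoinRoot (X ^ 2 - C f)) : ∃ p q : R,
    x = AdjoinRoot.of (X ^ 2 - C f) p +
      AdjoinRoot.of (X ^ 2 - C f) q * AdjoinRoot.root (X ^ 2 - C f) := by
  induction x using AdjoinRoot.induction_on with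
  | ih P =>
    induction P using Polynomial.induction_on with
    | C a => exact ⟨a, 0, by simp⟩
    | add P Q hP hQ =>
      obtain ⟨p, q, h⟩ := hP
      obtain ⟨p', q', h'⟩ := hQ
      exact ⟨p + p', q + q', by rw [map_add, h, h', map_add, map_add]; ring⟩
    | monomial n a h =>
      obtain ⟨p, q, h⟩ := h
      refine ⟨q * f, p, ?_⟩
      rw [pow_succ X n, ← mul_assoc, map_mul, h, AdjoinRoot.mk_X, map_mul, ← root_sq]
      ring

theorem eq_zero_of_add_mul_root [Nontrivial R] {p q : R} (h : AdjoinRoot.of (X ^ 2 - C f) p +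
    AdjoinRoot.of (X ^ 2 - C f) q * AdjoinRoot.root (X ^ 2 - C f) = 0) : p = 0 ∧ q = 0 := by
  have hm : (X ^ 2 - C f).Monic := monic_X_pow_sub_C f two_ne_zero
  have h' : AdjoinRoot.mk (X ^ 2 - C f) (C q * X + C p) = 0 := by
    rw [map_add, map_mul, AdjoinRoot.mk_X, AdjoinRoot.mk_C, AdjoinRoot.mk_C, add_comm, h]
  rw [AdjoinRoot.mk_eq_zero] at h'
  have hz : C q * X + C p = 0 := by
    by_contra hne
    refine hm.not_dvd_of_degree_lt hne ?_ h'
    rw [degree_X_pow_sub_C two_pos f]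
    exact degree_linear_le.trans_lt (by norm_num)
  have h0 := congrArg (coeff · 0) hz
  have h1 := congrArg (coeff · 1) hz
  simp [coeff_C] at h0 h1
  exact ⟨h0, h1⟩

theorem ext_iff [Nontrivial R] {p q p' q' : R} : AdjoinRoot.of (X ^ 2 - C f) p +
    AdjoinRoot.of (X ^ 2 - C f) q * AdjoinRoot.root (X ^ 2 - C f) =
      AdjoinRoot.of (X ^ 2 - C f) p' +
    AdjoinRoot.of (X ^ 2 - C f) q' * AdjoinRoot.root (X ^ 2 - C f) ↔ p = p' ∧ q = q' := by
  refine ⟨fun h => ?_, by rintro ⟨rfl, rfl⟩; rfl⟩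
  have := eq_zero_of_add_mul_root (f := f) (p := p - p') (q := q - q')
    (by rw [map_sub, map_sub]; linear_combination h)
  exact ⟨sub_eq_zero.1 this.1, sub_eq_zero.1 this.2⟩

/-- The product with the conjugate `p - q √f` is the norm `p² - q² f`. -/
theorem isDomain [IsDomain R] (hf : ∀ p q : R, p ^ 2 = q ^ 2 * f → q = 0) :
    IsDomain (AdjoinRoot (X ^ 2 - C f)) := by
  have : Nontrivial (AdjoinRoot (X ^ 2 - C f)) := by
    refine ⟨0, 1, fun h => ?_⟩
    have := eq_zero_of_add_mul_root (f := f) (p := 1) (q := 0) (by simp [← h])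
    exact one_ne_zero this.1
  have : NoZeroDivisors (AdjoinRoot (X ^ 2 - C f)) := by
    refine ⟨fun {x y} hxy => ?_⟩
    obtain ⟨p, q, rfl⟩ := exists_eq_add_mul_root x
    obtain ⟨r, s, rfl⟩ := exists_eq_add_mul_root y
    by_cases hN : p ^ 2 = q ^ 2 * f
    · have hq := hf p q hN
      subst hq
      have hp : p = 0 := by simpa using hN
      simp [hp]
    right
    have e1 : AdjoinRoot.of (X ^ 2 - C f) ((p ^ 2 - q ^ 2 * f) * r) +
        AdjoinRoot.of (X ^ 2 - C f) ((p ^ 2 - q ^ 2 * f) * s) * AdjoinRoot.root (X ^ 2 - C f) =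
          0 := by
      simp only [map_mul, map_sub, map_pow, ← root_sq]
      linear_combination (AdjoinRoot.of (X ^ 2 - C f) p -
        AdjoinRoot.of (X ^ 2 - C f) q * AdjoinRoot.root (X ^ 2 - C f)) * hxy
    obtain ⟨h1, h2⟩ := eq_zero_of_add_mul_root e1
    have hN' : p ^ 2 - q ^ 2 * f ≠ 0 := sub_ne_zero.2 hN
    rw [(mul_eq_zero.1 h1).resolve_left hN', (mul_eq_zero.1 h2).resolve_left hN']
    simp
  exact NoZeroDivisors.to_isDomain _

theorem isUnit_norm [Nontrivial R] {p q : R} (h : IsUnit (AdjoinRoot.of (X ^ 2 - C f) p +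
    AdjoinRoot.of (X ^ 2 - C f) q * AdjoinRoot.root (X ^ 2 - C f))) :
    IsUnit (p ^ 2 - q ^ 2 * f) := by
  obtain ⟨y, hy⟩ := h.exists_right_inv
  obtain ⟨r, s, rfl⟩ := exists_eq_add_mul_root y
  have e : AdjoinRoot.of (X ^ 2 - C f) (p * r + q * s * f) +
      AdjoinRoot.of (X ^ 2 - C f) (p * s + q * r) * AdjoinRoot.root (X ^ 2 - C f) =
      AdjoinRoot.of (X ^ 2 - C f) 1 +
      AdjoinRoot.of (X ^ 2 - C f) 0 * AdjoinRoot.root (X ^ 2 - C f) := by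
    simp only [map_mul, map_add, map_zero, map_one, ← root_sq]
    linear_combination hy
  obtain ⟨e1, e2⟩ := ext_iff.1 e
  refine IsUnit.of_mul_eq_one (r ^ 2 - s ^ 2 * f) ?_
  linear_combination (p * r + q * s * f + 1) * e1 - f * (p * s + q * r) * e2

/-- The basis `1, √f` of a quadratic extension. -/
noncomputable def basis [Nontrivial R] (f : R) :
    Module.Basis (Fin 2) R (AdjoinRoot (X ^ 2 - C f)) :=
  Module.Basis.mk (v := ![1, AdjoinRoot.root (X ^ 2 - C f)])
    (by
      rw [LinearIndependent.pair_iff]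
      intro s t h
      exact eq_zero_of_add_mul_root (f := f) (by simpa [Algebra.smul_def] using h))
    (by
      rintro x -
      obtain ⟨p, q, rfl⟩ := exists_eq_add_mul_root x
      rw [Matrix.range_cons, Matrix.range_cons, Matrix.range_empty, Set.union_empty]
      exact Submodule.mem_span_pair.2 ⟨p, q, by simp [Algebra.smul_def]⟩)

@[simp] theorem basis_zero [Nontrivial R] (f : R) : basis f 0 = 1 := by simp [basis]

@[simp] theorem basis_one [Nontrivial R] (f : R) :
    basis f 1 = AdjoinRoot.root (X ^ 2 - C f) := by simp [basis]

end QuadraticExtension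

/-! ### Laurent polynomials -/

section Laurent

open Polynomial

theorem natDegree_le_of_sub_eq_C_mul_X_pow {R : Type*} [CommRing R] {U W : R[X]} {c : R} {k : ℕ}
    (hW : W ≠ 0) (hne : U.natDegree ≠ W.natDegree) (h : U - W = C c * X ^ k) :
    W.natDegree ≤ k := by
  have hk : ∀ n, (U - W).coeff n ≠ 0 → n = k := by
    intro n hn
    rw [h, coeff_C_mul_X_pow] at hn
    by_contra hc
    exact hn (if_neg hc)
  rcases lt_or_gt_of_ne hne with hlt | hlt
  · refine (hk _ ?_).le
    rw [coeff_sub, coeff_eq_zero_of_natDegree_lt hlt, zero_sub, neg_ne_zero]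
    exact leadingCoeff_ne_zero.2 hW
  · rw [← hk U.natDegree ?_]
    · exact hlt.le
    · rw [coeff_sub, coeff_eq_zero_of_natDegree_lt hlt, sub_zero]
      exact leadingCoeff_ne_zero.2 (by rintro rfl; simp at hlt)

theorem le_natTrailingDegree_of_sub_eq_C_mul_X_pow {R : Type*} [CommRing R] {U W : R[X]} {c : R}
    {k : ℕ} (hW : W ≠ 0) (hne : U ≠ 0 → U.natTrailingDegree ≠ W.natTrailingDegree)
    (h : U - W = C c * X ^ k) : k ≤ W.natTrailingDegree := by
  have hk : ∀ n, (U - W).coeff n ≠ 0 → n = k := by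
    intro n hn
    rw [h, coeff_C_mul_X_pow] at hn
    by_contra hc
    exact hn (if_neg hc)
  by_cases hU : U = 0
  · refine (hk _ ?_).ge
    rw [coeff_sub, hU, coeff_zero, zero_sub, neg_ne_zero]
    exact trailingCoeff_nonzero_iff_nonzero.2 hW
  rcases lt_or_gt_of_ne (hne hU) with hlt | hlt
  · rw [← hk U.natTrailingDegree ?_]
    · exact hlt.le
    · rw [coeff_sub, coeff_eq_zero_of_lt_natTrailingDegree hlt, sub_zero]
      exact trailingCoeff_nonzero_iff_nonzero.2 hU
  · refine (hk _ ?_).ge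
    rw [coeff_sub, coeff_eq_zero_of_lt_natTrailingDegree hlt, zero_sub, neg_ne_zero]
    exact trailingCoeff_nonzero_iff_nonzero.2 hW

variable {K : Type*} [Field K]

/-- The polynomial `4 X (X² + a X + b)`. -/
noncomputable def cubicPoly (a b : K) : K[X] := C 4 * X ^ 3 + C (4 * a) * X ^ 2 + C (4 * b) * X

theorem natDegree_cubicPoly [CharZero K] (a b : K) : (cubicPoly a b).natDegree = 3 := by
  have := natDegree_cubic (a := (4 : K)) (b := 4 * a) (c := 4 * b) (d := 0) (by norm_num)
  simpa [cubicPoly] using this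

theorem cubicPoly_ne_zero [CharZero K] (a b : K) : cubicPoly a b ≠ 0 := by
  intro h
  have := natDegree_cubicPoly a b
  simp [h] at this

theorem natTrailingDegree_cubicPoly [CharZero K] (a : K) {b : K} (hb : b ≠ 0) :
    (cubicPoly a b).natTrailingDegree = 1 := by
  refine le_antisymm (natTrailingDegree_le_of_ne_zero ?_) ?_
  · simp [cubicPoly, coeff_X_pow, mul_assoc, hb]
  · refine le_natTrailingDegree (cubicPoly_ne_zero a b) fun m hm => ?_
    have : m = 0 := by omega
    subst this
    simp [cubicPoly]

/-- The two terms of a norm `p² - q² f` have degrees of different parity at `∞`. -/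
theorem eq_zero_of_sq_eq_sq_mul_cubicPoly [CharZero K] {a b : K} {P Q : K[X]}
    (h : P ^ 2 = Q ^ 2 * cubicPoly a b) : Q = 0 := by
  by_contra hQ
  have := congrArg natDegree h
  rw [natDegree_pow, natDegree_mul (pow_ne_zero 2 hQ) (cubicPoly_ne_zero a b), natDegree_pow,
    natDegree_cubicPoly] at this
  omega

/-- The two terms of a norm `p² - q² f` have degrees of different parity at `∞` and at `0`, so that
the norm is a monomial only if the second term is absent. -/
theorem eq_zero_of_sq_sub_sq_mul_cubicPoly [CharZero K] {a b c : K} (hb : b ≠ 0) {P Q : K[X]}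
    {k : ℕ} (h : P ^ 2 - Q ^ 2 * cubicPoly a b = C c * X ^ k) : Q = 0 := by
  by_contra hQ
  have hF := cubicPoly_ne_zero a b
  have hW : Q ^ 2 * cubicPoly a b ≠ 0 := mul_ne_zero (pow_ne_zero 2 hQ) hF
  have h1 : (Q ^ 2 * cubicPoly a b).natDegree = 2 * Q.natDegree + 3 := by
    rw [natDegree_mul (pow_ne_zero 2 hQ) hF, natDegree_pow, natDegree_cubicPoly]
  have h2 : (Q ^ 2 * cubicPoly a b).natTrailingDegree = 2 * Q.natTrailingDegree + 1 := by
    rw [natTrailingDegree_mul (pow_ne_zero 2 hQ) hF, sq, natTrailingDegree_mul hQ hQ,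
      natTrailingDegree_cubicPoly a hb]
    ring
  have i1 := natDegree_le_of_sub_eq_C_mul_X_pow hW (by rw [h1, natDegree_pow]; omega) h
  have i2 := le_natTrailingDegree_of_sub_eq_C_mul_X_pow hW (fun hP => by
    have hP : P ≠ 0 := by rintro rfl; simp at hP
    rw [h2, sq, natTrailingDegree_mul hP hP]; omega) h
  have := Q.natTrailingDegree_le_natDegree
  omega

theorem LaurentPolynomial.exists_common_T_pow {R : Type*} [CommRing R] (p q : R[T;T⁻¹]) :
    ∃ (n : ℕ) (P Q : R[X]), toLaurent P = p * LaurentPolynomial.T n ∧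
      toLaurent Q = q * LaurentPolynomial.T n := by
  obtain ⟨n, P, hP⟩ := p.exists_T_pow
  obtain ⟨m, Q, hQ⟩ := q.exists_T_pow
  refine ⟨n + m, P * X ^ m, Q * X ^ n, ?_, ?_⟩
  · rw [map_mul, hP, toLaurent_X_pow, mul_assoc, ← LaurentPolynomial.T_add, Nat.cast_add]
  · rw [map_mul, hQ, toLaurent_X_pow, mul_assoc, ← LaurentPolynomial.T_add, Nat.cast_add,
      add_comm (m : ℤ)]

theorem LaurentPolynomial.T_ne_zero {R : Type*} [CommRing R] [Nontrivial R] (n : ℤ) :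
    (LaurentPolynomial.T n : R[T;T⁻¹]) ≠ 0 := (LaurentPolynomial.isUnit_T n).ne_zero

theorem LaurentPolynomial.eq_C_mul_T_of_isUnit {u : K[T;T⁻¹]} (hu : IsUnit u) :
    ∃ (c : K) (n : ℤ), c ≠ 0 ∧ u = LaurentPolynomial.C c * LaurentPolynomial.T n := by
  obtain ⟨v, hv⟩ := hu.exists_right_inv
  obtain ⟨n, U, V, hU, hV⟩ := LaurentPolynomial.exists_common_T_pow u v
  have hUV : U * V = X ^ (n + n) := by
    apply toLaurent_injective
    rw [map_mul, hU, hV, toLaurent_X_pow, Nat.cast_add, LaurentPolynomial.T_add]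
    linear_combination LaurentPolynomial.T n * LaurentPolynomial.T n * hv
  obtain ⟨i, -, hi⟩ := (dvd_prime_pow (prime_X (R := K)) (n + n)).1 (Dvd.intro V hUV)
  obtain ⟨w, hw⟩ := hi.symm
  obtain ⟨c, hc, hcw⟩ := Polynomial.isUnit_iff.1 w.isUnit
  refine ⟨c, i - n, hc.ne_zero, ?_⟩
  have e : u * LaurentPolynomial.T n = LaurentPolynomial.T i * LaurentPolynomial.C c := by
    rw [← hU, ← hw, ← hcw, map_mul, toLaurent_X_pow, toLaurent_C]
  calc u = u * LaurentPolynomial.T n * LaurentPolynomial.T (-n) := by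
        rw [mul_assoc, ← LaurentPolynomial.T_add, add_neg_cancel, LaurentPolynomial.T_zero, mul_one]
    _ = _ := by
        rw [e, LaurentPolynomial.T_sub]; ring

end Laurent

/-! ### Functions on the punctured cubic curve -/

namespace PuncturedCurve

variable (e₁ e₂ : ℂ)

/-- With `T = X - e₁` the cubic is `4 T (T² + 3 e₁ T + b)`, and this is the coefficient `b`. -/
def quadCoeff : ℂ := (e₁ - e₂) * (e₁ - -(e₁ + e₂))

theorem cubic_eq : cubic e₁ e₂ = LaurentPolynomial.C 4 * (LaurentPolynomial.T 3 +
    LaurentPolynomial.C (3 * e₁) * LaurentPolynomial.T 2 +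
    LaurentPolynomial.C (quadCoeff e₁ e₂) * LaurentPolynomial.T 1) := by
  have h2 : (LaurentPolynomial.T 2 : ℂ[T;T⁻¹]) = LaurentPolynomial.T 1 ^ 2 := by
    rw [LaurentPolynomial.T_pow]; norm_num
  have h3 : (LaurentPolynomial.T 3 : ℂ[T;T⁻¹]) = LaurentPolynomial.T 1 ^ 3 := by
    rw [LaurentPolynomial.T_pow]; norm_num
  simp only [cubic, xCoord, h2, h3, quadCoeff, map_mul, map_sub, map_neg, map_add,
    map_ofNat]
  ring

theorem toLaurent_cubicPoly :
    Polynomial.toLaurent (cubicPoly (3 * e₁) (quadCoeff e₁ e₂)) = cubic e₁ e₂ := by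
  rw [cubic_eq, cubicPoly]
  simp only [map_add, map_mul, Polynomial.toLaurent_C, Polynomial.toLaurent_X_pow,
    Polynomial.toLaurent_X, Nat.cast_ofNat]
  ring

instance : IsDomain (FunctionAlgebra e₁ e₂) := by
  refine QuadraticExtension.isDomain fun p q h => ?_
  obtain ⟨n, P, Q, hP, hQ⟩ := LaurentPolynomial.exists_common_T_pow p q
  have hPQ : P ^ 2 = Q ^ 2 * cubicPoly (3 * e₁) (quadCoeff e₁ e₂) := by
    apply Polynomial.toLaurent_injective
    rw [map_mul, map_pow, map_pow, hP, hQ, toLaurent_cubicPoly]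
    linear_combination LaurentPolynomial.T n ^ 2 * h
  rw [eq_zero_of_sq_eq_sq_mul_cubicPoly hPQ, map_zero] at hQ
  exact (mul_eq_zero.1 hQ.symm).resolve_right (LaurentPolynomial.T_ne_zero _)

instance : CharZero (FunctionAlgebra e₁ e₂) :=
  charZero_of_injective_algebraMap (algebraMap ℂ (FunctionAlgebra e₁ e₂)).injective

/-- The function `T ^ k = (X - e₁) ^ k` on the curve. -/
noncomputable def tau (k : ℤ) : FunctionAlgebra e₁ e₂ := ofX e₁ e₂ (LaurentPolynomial.T k)

theorem tau_add (i j : ℤ) : tau e₁ e₂ (i + j) = tau e₁ e₂ i * tau e₁ e₂ j := by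
  rw [tau, LaurentPolynomial.T_add, map_mul]; rfl

@[simp] theorem tau_zero : tau e₁ e₂ 0 = 1 := by
  rw [tau, LaurentPolynomial.T_zero, map_one]

theorem ofX_C (c : ℂ) : ofX e₁ e₂ (LaurentPolynomial.C c) = algebraMap ℂ _ c := rfl

theorem ofX_injective : Function.Injective (ofX e₁ e₂) := fun p q h =>
  (QuadraticExtension.ext_iff (p := p) (q := 0) (p' := q) (q' := 0)
    (f := cubic e₁ e₂)).1 (by simpa using h) |>.1

theorem ofX_ne_Y (p : ℂ[T;T⁻¹]) : ofX e₁ e₂ p ≠ Y e₁ e₂ := fun h =>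
  zero_ne_one ((QuadraticExtension.ext_iff (p := p) (q := 0) (p' := 0) (q' := 1)
    (f := cubic e₁ e₂)).1 (by simpa using h)).2

theorem Y_sq : Y e₁ e₂ ^ 2 = ofX e₁ e₂ (cubic e₁ e₂) := QuadraticExtension.root_sq

theorem tau_one_pow (n : ℕ) : tau e₁ e₂ 1 ^ n = tau e₁ e₂ n := by
  induction n with
  | zero => simp
  | succ n ih => rw [pow_succ, ih, ← tau_add, Nat.cast_add, Nat.cast_one]

theorem ofX_cubic : ofX e₁ e₂ (cubic e₁ e₂) = 4 * (tau e₁ e₂ 1 ^ 3 +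
    algebraMap ℂ _ (3 * e₁) * tau e₁ e₂ 1 ^ 2 +
    algebraMap ℂ _ (quadCoeff e₁ e₂) * tau e₁ e₂ 1) := by
  have h := congrArg (ofX e₁ e₂) (cubic_eq e₁ e₂)
  simp only [map_mul (ofX e₁ e₂), map_add (ofX e₁ e₂), ofX_C] at h
  rw [tau_one_pow, tau_one_pow]
  refine h.trans ?_
  rw [map_ofNat]
  rfl

theorem Y_sq_eq : Y e₁ e₂ ^ 2 = 4 * (tau e₁ e₂ 1 ^ 3 +
    algebraMap ℂ _ (3 * e₁) * tau e₁ e₂ 1 ^ 2 +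
    algebraMap ℂ _ (quadCoeff e₁ e₂) * tau e₁ e₂ 1) :=
  (Y_sq e₁ e₂).trans (ofX_cubic e₁ e₂)

theorem tau_eq_sub_one_mul (k : ℤ) : tau e₁ e₂ k = tau e₁ e₂ (k - 1) * tau e₁ e₂ 1 := by
  rw [← tau_add, sub_add_cancel]

theorem Y_ne_zero : Y e₁ e₂ ≠ 0 := by
  intro h
  exact ofX_ne_Y e₁ e₂ 0 (by rw [h, map_zero])

theorem tau_ne_zero (k : ℤ) : tau e₁ e₂ k ≠ 0 := by
  intro h
  have := tau_add e₁ e₂ k (-k)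
  simp [h] at this

/-- The units are the constant multiples of the powers of `X - e₁`, unless `e₁` is a multiple root
of the cubic. -/
theorem exists_eq_of_isUnit (hb : quadCoeff e₁ e₂ ≠ 0) {x : FunctionAlgebra e₁ e₂}
    (hx : IsUnit x) : ∃ (c : ℂ) (n : ℤ), c ≠ 0 ∧ x = algebraMap ℂ _ c * tau e₁ e₂ n := by
  obtain ⟨p, q, rfl⟩ := QuadraticExtension.exists_eq_add_mul_root x
  obtain ⟨c, k, hc, hN⟩ :=
    LaurentPolynomial.eq_C_mul_T_of_isUnit (QuadraticExtension.isUnit_norm hx)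
  have hq : q = 0 := by
    obtain ⟨n, P, Q, hP, hQ⟩ := LaurentPolynomial.exists_common_T_pow
      (p * LaurentPolynomial.T k.natAbs) (q * LaurentPolynomial.T k.natAbs)
    have hm : ∃ m : ℕ, (m : ℤ) = k + 2 * k.natAbs + 2 * n :=
      ⟨(k + 2 * k.natAbs + 2 * n).toNat, by omega⟩
    obtain ⟨m, hm⟩ := hm
    have hPQ : P ^ 2 - Q ^ 2 * cubicPoly (3 * e₁) (quadCoeff e₁ e₂) =
        Polynomial.C c * Polynomial.X ^ m := by
      apply Polynomial.toLaurent_injective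
      rw [map_sub, map_mul, map_mul, map_pow, map_pow, hP, hQ, toLaurent_cubicPoly,
        Polynomial.toLaurent_C, Polynomial.toLaurent_X_pow, hm, two_mul, two_mul,
        LaurentPolynomial.T_add, LaurentPolynomial.T_add, LaurentPolynomial.T_add,
        LaurentPolynomial.T_add]
      linear_combination LaurentPolynomial.T k.natAbs ^ 2 * LaurentPolynomial.T n ^ 2 * hN
    rw [eq_zero_of_sq_sub_sq_mul_cubicPoly hb hPQ, map_zero] at hQ
    have := (mul_eq_zero.1 hQ.symm).resolve_right (LaurentPolynomial.T_ne_zero _)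
    exact (mul_eq_zero.1 this).resolve_right (LaurentPolynomial.T_ne_zero _)
  subst hq
  have hp : IsUnit p := by
    refine (isUnit_pow_iff two_ne_zero).1 (IsUnit.of_mul_eq_one ?_ ?_)
    · exact LaurentPolynomial.C c⁻¹ * LaurentPolynomial.T (-k)
    · have : p ^ 2 = LaurentPolynomial.C c * LaurentPolynomial.T k := by simpa using hN
      rw [this, mul_mul_mul_comm, ← map_mul, ← LaurentPolynomial.T_add, mul_inv_cancel₀ hc]
      simp
  obtain ⟨c', n, hc', rfl⟩ := LaurentPolynomial.eq_C_mul_T_of_isUnit hp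
  exact ⟨c', n, hc', by rw [map_zero, zero_mul, add_zero, map_mul, ofX_C]; rfl⟩

/-- The integer `2k + 1` corresponds to the pair `(k, 0)`, and `2k` to `(k - 2, 1)`. -/
def indexEquiv : ℤ × Fin 2 ≃ ℤ where
  toFun x := if x.2 = 0 then 2 * x.1 + 1 else 2 * (x.1 + 2)
  invFun n := if Odd n then (n / 2, 0) else (n / 2 - 2, 1)
  left_inv := by
    rintro ⟨k, i⟩
    fin_cases i
    · simp; omega
    · simp
  right_inv n := by
    rcases Int.even_or_odd' n with ⟨k, rfl | rfl⟩
    · simp [show ¬ Odd (2 * k) by simp]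
    · simp [show Odd (2 * k + 1) from ⟨k, rfl⟩]; omega

/-- The basis `T ^ k`, `T ^ k Y` of the algebra of functions. -/
noncomputable def functionBasis : Module.Basis (ℤ × Fin 2) ℂ (FunctionAlgebra e₁ e₂) :=
  (AddMonoidAlgebra.basis ℤ ℂ).smulTower (QuadraticExtension.basis (cubic e₁ e₂))

theorem functionBasis_zero (k : ℤ) : functionBasis e₁ e₂ (k, 0) = tau e₁ e₂ k := by
  rw [functionBasis, Module.Basis.smulTower_apply, QuadraticExtension.basis_zero,
    Algebra.smul_def, mul_one]
  rfl

theorem functionBasis_one (k : ℤ) : functionBasis e₁ e₂ (k, 1) = tau e₁ e₂ k * Y e₁ e₂ := by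
  rw [functionBasis, Module.Basis.smulTower_apply, QuadraticExtension.basis_one,
    Algebra.smul_def]
  rfl

theorem function_induction {P : FunctionAlgebra e₁ e₂ → Prop} (x : FunctionAlgebra e₁ e₂)
    (tau : ∀ k, P (tau e₁ e₂ k)) (tau_mul_Y : ∀ k, P (PuncturedCurve.tau e₁ e₂ k * Y e₁ e₂))
    (add : ∀ x y, P x → P y → P (x + y)) (smul : ∀ (c : ℂ) x, P x → P (c • x)) : P x := by
  have hx := (functionBasis e₁ e₂).mem_span x
  induction hx using Submodule.span_induction with
  | mem x h =>
    obtain ⟨⟨k, i⟩, rfl⟩ := h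
    fin_cases i
    · exact (functionBasis_zero e₁ e₂ k).symm ▸ tau k
    · exact (functionBasis_one e₁ e₂ k).symm ▸ tau_mul_Y k
  | zero => simpa using smul 0 _ (tau 0)
  | add x y _ _ hx hy => exact add x y hx hy
  | smul c x _ hx => exact smul c x hx

/-- `f'(X) / 2` as a function on the curve. -/
noncomputable def halfDeriv : FunctionAlgebra e₁ e₂ :=
  6 * tau e₁ e₂ 1 ^ 2 + 4 * algebraMap ℂ _ (3 * e₁) * tau e₁ e₂ 1 +
    2 * algebraMap ℂ _ (quadCoeff e₁ e₂)

/-- The linear map underlying the vector field `Y d/dX`. -/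
noncomputable def invariantLinear : FunctionAlgebra e₁ e₂ →ₗ[ℂ] FunctionAlgebra e₁ e₂ :=
  (functionBasis e₁ e₂).constr ℂ fun x =>
    if x.2 = 0 then (x.1 : FunctionAlgebra e₁ e₂) * tau e₁ e₂ (x.1 - 1) * Y e₁ e₂
    else (x.1 : FunctionAlgebra e₁ e₂) * tau e₁ e₂ (x.1 - 1) * Y e₁ e₂ ^ 2 +
      tau e₁ e₂ x.1 * halfDeriv e₁ e₂

theorem invariantLinear_tau (k : ℤ) :
    invariantLinear e₁ e₂ (tau e₁ e₂ k) =
      (k : FunctionAlgebra e₁ e₂) * tau e₁ e₂ (k - 1) * Y e₁ e₂ := by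
  rw [invariantLinear, ← functionBasis_zero, Module.Basis.constr_basis]
  simp

theorem invariantLinear_tau_mul_Y (k : ℤ) :
    invariantLinear e₁ e₂ (tau e₁ e₂ k * Y e₁ e₂) =
      (k : FunctionAlgebra e₁ e₂) * tau e₁ e₂ (k - 1) * Y e₁ e₂ ^ 2 +
        tau e₁ e₂ k * halfDeriv e₁ e₂ := by
  rw [invariantLinear, ← functionBasis_one, Module.Basis.constr_basis]
  simp

theorem invariantLinear_tau_mul_Y_sq (k : ℤ) :
    invariantLinear e₁ e₂ (tau e₁ e₂ k * Y e₁ e₂ ^ 2) =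
      (k : FunctionAlgebra e₁ e₂) * tau e₁ e₂ (k - 1) * Y e₁ e₂ ^ 3 +
        2 * tau e₁ e₂ k * Y e₁ e₂ * halfDeriv e₁ e₂ := by
  have e : tau e₁ e₂ k * Y e₁ e₂ ^ 2 = (4 : ℂ) • tau e₁ e₂ (k + (3 : ℕ)) +
      (4 * (3 * e₁)) • tau e₁ e₂ (k + (2 : ℕ)) + (4 * quadCoeff e₁ e₂) • tau e₁ e₂ (k + 1) := by
    simp only [tau_add, ← tau_one_pow, Algebra.smul_def, map_mul, map_ofNat]
    have hY := Y_sq_eq e₁ e₂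
    rw [map_mul, map_ofNat] at hY
    linear_combination tau e₁ e₂ k * hY
  have e3 : tau e₁ e₂ (k + (3 : ℕ) - 1) = tau e₁ e₂ (k - 1) * tau e₁ e₂ 1 ^ 3 := by
    rw [tau_one_pow, ← tau_add]; congr 1; ring
  have e2 : tau e₁ e₂ (k + (2 : ℕ) - 1) = tau e₁ e₂ (k - 1) * tau e₁ e₂ 1 ^ 2 := by
    rw [tau_one_pow, ← tau_add]; congr 1; ring
  have e1 : tau e₁ e₂ (k + 1 - 1) = tau e₁ e₂ (k - 1) * tau e₁ e₂ 1 := by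
    rw [← tau_add]; congr 1; ring
  rw [e]
  simp only [map_add, map_smul, invariantLinear_tau, halfDeriv, e1, e2, e3]
  rw [tau_eq_sub_one_mul e₁ e₂ k]
  simp only [Algebra.smul_def, map_mul, map_ofNat]
  push_cast
  have hY := Y_sq_eq e₁ e₂
  rw [map_mul, map_ofNat] at hY
  linear_combination (-(k : FunctionAlgebra e₁ e₂) * tau e₁ e₂ (k - 1) * Y e₁ e₂) * hY

/-- The vector field `Y d/dX` on the curve. -/
noncomputable def invariantField : VectorFields e₁ e₂ :=
  Derivation.mk' (invariantLinear e₁ e₂) (by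
    have e : ∀ i j : ℤ, tau e₁ e₂ (i + j - 1) =
        tau e₁ e₂ (i - 1) * tau e₁ e₂ (j - 1) * tau e₁ e₂ 1 := by
      intro i j; rw [← tau_add, ← tau_add]; congr 1; ring
    intro x y
    induction x using function_induction with
    | add x x' hx hx' => simp only [add_mul, map_add, hx, hx', smul_eq_mul]; ring
    | smul c x hx => simp only [smul_mul_assoc, map_smul, hx, smul_eq_mul, mul_smul_comm, smul_add]
    | tau i =>
      induction y using function_induction with
      | add x x' hx hx' => simp only [mul_add, map_add, hx, hx', smul_eq_mul]; ring
      | smul c x hx =>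
        simp only [smul_mul_assoc, map_smul, hx, smul_eq_mul, mul_smul_comm, smul_add]
      | tau j =>
        rw [← tau_add, invariantLinear_tau, invariantLinear_tau, invariantLinear_tau, e,
          tau_eq_sub_one_mul e₁ e₂ i, tau_eq_sub_one_mul e₁ e₂ j]
        simp only [smul_eq_mul]; push_cast; ring
      | tau_mul_Y j =>
        rw [← mul_assoc, ← tau_add, invariantLinear_tau, invariantLinear_tau_mul_Y,
          invariantLinear_tau_mul_Y, e, tau_add, tau_eq_sub_one_mul e₁ e₂ i,
          tau_eq_sub_one_mul e₁ e₂ j]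
        simp only [smul_eq_mul]; push_cast; ring
    | tau_mul_Y i =>
      induction y using function_induction with
      | add x x' hx hx' => simp only [mul_add, map_add, hx, hx', smul_eq_mul]; ring
      | smul c x hx =>
        simp only [smul_mul_assoc, map_smul, hx, smul_eq_mul, mul_smul_comm, smul_add]
      | tau j =>
        rw [mul_right_comm, ← tau_add, invariantLinear_tau, invariantLinear_tau_mul_Y,
          invariantLinear_tau_mul_Y, e, tau_add, tau_eq_sub_one_mul e₁ e₂ i,
          tau_eq_sub_one_mul e₁ e₂ j]
        simp only [smul_eq_mul]; push_cast; ring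
      | tau_mul_Y j =>
        rw [mul_mul_mul_comm, ← tau_add, ← sq, invariantLinear_tau_mul_Y_sq,
          invariantLinear_tau_mul_Y,
          invariantLinear_tau_mul_Y, e, tau_add, tau_eq_sub_one_mul e₁ e₂ i,
          tau_eq_sub_one_mul e₁ e₂ j]
        simp only [smul_eq_mul]; push_cast; ring)

theorem invariantField_tau (k : ℤ) : invariantField e₁ e₂ (tau e₁ e₂ k) =
    (k : FunctionAlgebra e₁ e₂) * tau e₁ e₂ (k - 1) * Y e₁ e₂ :=
  invariantLinear_tau e₁ e₂ k

theorem invariantField_tau_mul_Y (k : ℤ) :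
    invariantField e₁ e₂ (tau e₁ e₂ k * Y e₁ e₂) =
      (k : FunctionAlgebra e₁ e₂) * tau e₁ e₂ (k - 1) * Y e₁ e₂ ^ 2 +
        tau e₁ e₂ k * halfDeriv e₁ e₂ :=
  invariantLinear_tau_mul_Y e₁ e₂ k

theorem invariantField_Y : invariantField e₁ e₂ (Y e₁ e₂) = halfDeriv e₁ e₂ := by
  have := invariantLinear_tau_mul_Y e₁ e₂ 0
  rw [tau_zero, one_mul, one_mul, Int.cast_zero, zero_mul, zero_mul, zero_add] at this
  exact this

theorem invariantField_ne_zero : invariantField e₁ e₂ ≠ 0 := by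
  intro h
  have := invariantField_tau e₁ e₂ 1
  rw [h, sub_self, tau_zero, Int.cast_one, one_mul, one_mul] at this
  exact Y_ne_zero e₁ e₂ this.symm

/-! ### The vector field algebras as Wronskian algebras -/

/-- The function `g` for which the basis element `V_n` corresponds to the vector field `g Y d/dX`:
`T ^ k` for `n = 2k + 1`, and `Y T ^ (k - 2) / 2` for `n = 2k`. -/
noncomputable def vectorFieldBasis : Module.Basis ℤ ℂ (FunctionAlgebra e₁ e₂) :=
  ((functionBasis e₁ e₂).unitsSMul
    fun x => if x.2 = 0 then 1 else Units.mk0 (1 / 2 : ℂ) (by norm_num)).reindex indexEquiv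

theorem vectorFieldBasis_odd (k : ℤ) : vectorFieldBasis e₁ e₂ (2 * k + 1) = tau e₁ e₂ k := by
  have : (2 * k + 1) = indexEquiv (k, 0) := rfl
  rw [vectorFieldBasis, this, Module.Basis.reindex_apply, Equiv.symm_apply_apply,
    Module.Basis.unitsSMul_apply, functionBasis_zero]
  simp

theorem vectorFieldBasis_even (k : ℤ) : vectorFieldBasis e₁ e₂ (2 * k) =
    (1 / 2 : ℂ) • (tau e₁ e₂ (k - 2) * Y e₁ e₂) := by
  have : (2 * k) = indexEquiv (k - 2, 1) := by simp [indexEquiv]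
  rw [vectorFieldBasis, this, Module.Basis.reindex_apply, Equiv.symm_apply_apply,
    Module.Basis.unitsSMul_apply, functionBasis_one]
  rfl

/-- The algebra of the two-parameter family is the algebra of functions on the punctured curve with
the Wronskian bracket; this holds for singular cubics as well. -/
noncomputable def toFunction : KNAlgebra e₁ e₂ ≃ₗ[ℂ] FunctionAlgebra e₁ e₂ :=
  (vectorFieldBasis e₁ e₂).repr.symm

theorem toFunction_V (n : ℤ) :
    toFunction e₁ e₂ (KNAlgebra.V e₁ e₂ n) = vectorFieldBasis e₁ e₂ n :=
  (vectorFieldBasis e₁ e₂).repr_symm_single_one n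

theorem repr_symm_knBasisBracket_odd_even (i j : ℤ) :
    (vectorFieldBasis e₁ e₂).repr.symm (knBasisBracket e₁ e₂ (2 * i + 1) (2 * j)) =
      wronskian (invariantField e₁ e₂) (vectorFieldBasis e₁ e₂ (2 * i + 1))
        (vectorFieldBasis e₁ e₂ (2 * j)) := by
  have t0 : tau e₁ e₂ (i + j) = tau e₁ e₂ (i - 1) * tau e₁ e₂ (j - 2 - 1) * tau e₁ e₂ 1 ^ 4 := by
    rw [tau_one_pow, ← tau_add, ← tau_add]; congr 1; push_cast; ring
  have t1 : tau e₁ e₂ (i + j - 1) =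
      tau e₁ e₂ (i - 1) * tau e₁ e₂ (j - 2 - 1) * tau e₁ e₂ 1 ^ 3 := by
    rw [tau_one_pow, ← tau_add, ← tau_add]; congr 1; push_cast; ring
  have t2 : tau e₁ e₂ (i + j - 2) =
      tau e₁ e₂ (i - 1) * tau e₁ e₂ (j - 2 - 1) * tau e₁ e₂ 1 ^ 2 := by
    rw [tau_one_pow, ← tau_add, ← tau_add]; congr 1; push_cast; ring
  have hY := Y_sq_eq e₁ e₂
  have h2 : (algebraMap ℂ (FunctionAlgebra e₁ e₂)) (1 / 2) * 2 = 1 := by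
    rw [← map_ofNat (algebraMap ℂ (FunctionAlgebra e₁ e₂)) 2, ← map_mul]; norm_num
  have hq : (e₁ - e₂) * (e₁ - -(e₁ + e₂)) = quadCoeff e₁ e₂ := rfl
  simp only [knBasisBracket, show Odd (2 * i + 1) from ⟨i, rfl⟩, show ¬ Odd (2 * j) by simp,
    hq, if_true, if_false, map_add, map_smul, Module.Basis.repr_symm_single_one]
  rw [show 2 * i + 1 + 2 * j = 2 * (i + j) + 1 by ring,
    show 2 * (i + j) + 1 - 2 = 2 * (i + j - 1) + 1 by ring,
    show 2 * (i + j) + 1 - 4 = 2 * (i + j - 2) + 1 by ring]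
  simp only [vectorFieldBasis_odd, vectorFieldBasis_even, wronskian, Derivation.map_smul,
    invariantField_tau,
    invariantField_tau_mul_Y, t0, t1, t2]
  rw [tau_eq_sub_one_mul e₁ e₂ i, tau_eq_sub_one_mul e₁ e₂ (j - 2)]
  generalize tau e₁ e₂ (i - 1) = p
  generalize tau e₁ e₂ (j - 2 - 1) = q
  simp only [Algebra.smul_def, halfDeriv, map_mul, map_ofNat, map_intCast] at hY h2 ⊢
  generalize algebraMap ℂ (FunctionAlgebra e₁ e₂) (1 / 2) = c at *
  generalize algebraMap ℂ (FunctionAlgebra e₁ e₂) e₁ = E at *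
  generalize algebraMap ℂ (FunctionAlgebra e₁ e₂) (quadCoeff e₁ e₂) = B at *
  generalize tau e₁ e₂ 1 = x at *
  generalize Y e₁ e₂ = y at *
  push_cast
  linear_combination -(c * p * q * x * ((j : FunctionAlgebra e₁ e₂) - 2 - i)) * hY -
    p * q * x * ((2 * j - 2 * i - 4) * (x ^ 3 + 3 * E * x ^ 2 + B * x) +
      x * (3 * x ^ 2 + 6 * E * x + B)) * h2

theorem repr_symm_knBasisBracket (n m : ℤ) :
    (vectorFieldBasis e₁ e₂).repr.symm (knBasisBracket e₁ e₂ n m) =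
      wronskian (invariantField e₁ e₂) (vectorFieldBasis e₁ e₂ n) (vectorFieldBasis e₁ e₂ m) := by
  have wskew : ∀ f g : FunctionAlgebra e₁ e₂, wronskian (invariantField e₁ e₂) f g =
      -wronskian (invariantField e₁ e₂) g f := by
    intro f g; simp only [wronskian]; ring
  rcases Int.even_or_odd' n with ⟨i, rfl | rfl⟩ <;> rcases Int.even_or_odd' m with ⟨j, rfl | rfl⟩
  · have t0 : tau e₁ e₂ (i + j - 2) =
        tau e₁ e₂ (i - 2 - 1) * tau e₁ e₂ (j - 2 - 1) * tau e₁ e₂ 1 ^ 4 := by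
      rw [tau_one_pow, ← tau_add, ← tau_add]; congr 1; push_cast; ring
    have t1 : tau e₁ e₂ (i + j - 1 - 2) =
        tau e₁ e₂ (i - 2 - 1) * tau e₁ e₂ (j - 2 - 1) * tau e₁ e₂ 1 ^ 3 := by
      rw [tau_one_pow, ← tau_add, ← tau_add]; congr 1; push_cast; ring
    have t2 : tau e₁ e₂ (i + j - 2 - 2) =
        tau e₁ e₂ (i - 2 - 1) * tau e₁ e₂ (j - 2 - 1) * tau e₁ e₂ 1 ^ 2 := by
      rw [tau_one_pow, ← tau_add, ← tau_add]; congr 1; push_cast; ring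
    have hY := Y_sq_eq e₁ e₂
    have h2 : (algebraMap ℂ (FunctionAlgebra e₁ e₂)) (1 / 2) * 2 = 1 := by
      rw [← map_ofNat (algebraMap ℂ (FunctionAlgebra e₁ e₂)) 2, ← map_mul]; norm_num
    have hq : (e₁ - e₂) * (e₁ - -(e₁ + e₂)) = quadCoeff e₁ e₂ := rfl
    simp only [knBasisBracket, show ¬ Odd (2 * i) by simp, show ¬ Odd (2 * j) by simp,
      hq, if_false, map_add, map_smul, Module.Basis.repr_symm_single_one]
    rw [show 2 * i + 2 * j = 2 * (i + j) by ring,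
      show 2 * (i + j) - 2 = 2 * (i + j - 1) by ring,
      show 2 * (i + j) - 4 = 2 * (i + j - 2) by ring]
    simp only [vectorFieldBasis_even, wronskian, Derivation.map_smul,
      invariantField_tau_mul_Y, t0, t1, t2]
    rw [tau_eq_sub_one_mul e₁ e₂ (i - 2), tau_eq_sub_one_mul e₁ e₂ (j - 2)]
    generalize tau e₁ e₂ (i - 2 - 1) = p
    generalize tau e₁ e₂ (j - 2 - 1) = q
    simp only [Algebra.smul_def, halfDeriv, map_mul, map_ofNat, map_intCast] at hY h2 ⊢
    generalize algebraMap ℂ (FunctionAlgebra e₁ e₂) (1 / 2) = c at *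
    generalize algebraMap ℂ (FunctionAlgebra e₁ e₂) e₁ = E at *
    generalize algebraMap ℂ (FunctionAlgebra e₁ e₂) (quadCoeff e₁ e₂) = B at *
    generalize tau e₁ e₂ 1 = x at *
    generalize Y e₁ e₂ = y at *
    push_cast
    linear_combination -(c ^ 2 * p * q * x * y * ((j : FunctionAlgebra e₁ e₂) - i)) * hY -
      2 * c * ((j : FunctionAlgebra e₁ e₂) - i) * p * q * x *
        (x ^ 3 + 3 * E * x ^ 2 + B * x) * y * h2
  · rw [knBasisBracket_skew, map_neg, repr_symm_knBasisBracket_odd_even, ← wskew]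
  · exact repr_symm_knBasisBracket_odd_even e₁ e₂ i j
  · have t : tau e₁ e₂ (i + j + 1 - 2) =
        tau e₁ e₂ (i - 1) * tau e₁ e₂ (j - 1) * tau e₁ e₂ 1 := by
      rw [← tau_add, ← tau_add]; congr 1; ring
    have h2 : (algebraMap ℂ (FunctionAlgebra e₁ e₂)) (1 / 2) * 2 = 1 := by
      rw [← map_ofNat (algebraMap ℂ (FunctionAlgebra e₁ e₂)) 2, ← map_mul]; norm_num
    simp only [knBasisBracket, show Odd (2 * i + 1) from ⟨i, rfl⟩,
      show Odd (2 * j + 1) from ⟨j, rfl⟩, if_true, map_smul, Module.Basis.repr_symm_single_one]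
    rw [show 2 * i + 1 + (2 * j + 1) = 2 * (i + j + 1) by ring]
    simp only [vectorFieldBasis_even, vectorFieldBasis_odd, wronskian, invariantField_tau, t]
    rw [tau_eq_sub_one_mul e₁ e₂ i, tau_eq_sub_one_mul e₁ e₂ j]
    simp only [Algebra.smul_def, map_intCast] at h2 ⊢
    generalize algebraMap ℂ (FunctionAlgebra e₁ e₂) (1 / 2) = c at *
    push_cast
    linear_combination ((j : FunctionAlgebra e₁ e₂) - i) * tau e₁ e₂ (i - 1) *
      tau e₁ e₂ (j - 1) * tau e₁ e₂ 1 * Y e₁ e₂ * h2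

theorem repr_symm_bilinExtend (x y : ℤ →₀ ℂ) :
    (vectorFieldBasis e₁ e₂).repr.symm (bilinExtend (knBasisBracket e₁ e₂) x y) =
      wronskian (invariantField e₁ e₂) ((vectorFieldBasis e₁ e₂).repr.symm x)
        ((vectorFieldBasis e₁ e₂).repr.symm y) := by
  induction x using Finsupp.induction_linear with
  | zero => simp [wronskian]
  | add f g hf hg =>
    simp only [map_add, LinearMap.add_apply, hf, hg, wronskian]; ring
  | single n r =>
    induction y using Finsupp.induction_linear with
    | zero => simp [wronskian]
    | add f g hf hg => simp only [map_add, hf, hg, wronskian]; ring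
    | single m s =>
      rw [bilinExtend_single, map_smul, map_smul, repr_symm_knBasisBracket,
        Module.Basis.repr_symm_single, Module.Basis.repr_symm_single]
      simp only [wronskian, Derivation.map_smul]
      simp only [Algebra.smul_def]
      ring

theorem toFunction_lie (x y : KNAlgebra e₁ e₂) :
    toFunction e₁ e₂ ⁅x, y⁆ =
      wronskian (invariantField e₁ e₂) (toFunction e₁ e₂ x) (toFunction e₁ e₂ y) :=
  repr_symm_bilinExtend e₁ e₂ x y

end PuncturedCurve

/-! ### Recovering the curve from the Lie algebra -/

namespace PuncturedCurve

theorem nonempty_algEquiv_of_lieEquiv {e₁ e₂ e₁' e₂' : ℂ}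
    (φ : KNAlgebra e₁ e₂ ≃ₗ⁅ℂ⁆ KNAlgebra e₁' e₂') :
    Nonempty (FunctionAlgebra e₁ e₂ ≃ₐ[ℂ] FunctionAlgebra e₁' e₂') := by
  refine nonempty_algEquiv_of_wronskian_equiv (invariantField_ne_zero e₁ e₂)
    (invariantField_ne_zero e₁' e₂')
    ((toFunction e₁ e₂).symm.trans (φ.toLinearEquiv.trans (toFunction e₁' e₂'))) fun f g => ?_
  obtain ⟨x, rfl⟩ := (toFunction e₁ e₂).surjective f
  obtain ⟨y, rfl⟩ := (toFunction e₁ e₂).surjective g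
  rw [← toFunction_lie]
  simp only [LinearEquiv.trans_apply, LinearEquiv.symm_apply_apply]
  rw [← toFunction_lie]
  exact congrArg _ (LieEquiv.map_lie φ x y)

variable {e₁ e₂ e₁' e₂' : ℂ}

theorem isUnit_tau (n : ℤ) : IsUnit (tau e₁ e₂ n) := by
  refine IsUnit.of_mul_eq_one (tau e₁ e₂ (-n)) ?_
  rw [← tau_add, add_neg_cancel, tau_zero]

theorem algebraMap_mul_tau (c : ℂ) (n : ℤ) : algebraMap ℂ (FunctionAlgebra e₁ e₂) c * tau e₁ e₂ n =
    ofX e₁ e₂ (LaurentPolynomial.C c * LaurentPolynomial.T n) := by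
  rw [map_mul]; rfl

theorem algEquiv_tau (ψ : FunctionAlgebra e₁ e₂ ≃ₐ[ℂ] FunctionAlgebra e₁' e₂') {c : ℂ} {k : ℤ}
    (hc : c ≠ 0) (h : ψ (tau e₁ e₂ 1) = algebraMap ℂ _ c * tau e₁' e₂' k) (n : ℤ) :
    ψ (tau e₁ e₂ n) = algebraMap ℂ _ (c ^ n) * tau e₁' e₂' (k * n) := by
  induction n with
  | zero => simp
  | succ n ih =>
    rw [tau_add, map_mul, ih, h, mul_add, mul_one, tau_add, zpow_add₀ hc, zpow_one, map_mul]
    ring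
  | pred n ih =>
    refine mul_right_cancel₀ (b := ψ (tau e₁ e₂ 1)) (by simp [tau_ne_zero]) ?_
    rw [← map_mul, ← tau_add, sub_add_cancel, ih, h, mul_mul_mul_comm, ← map_mul, ← tau_add,
      ← zpow_add_one₀ hc]
    congr 2
    · congr 1; ring
    · ring

/-- An isomorphism cannot send both coordinate functions to functions of `X` alone. -/
theorem not_mem_range_ofX (ψ : FunctionAlgebra e₁ e₂ ≃ₐ[ℂ] FunctionAlgebra e₁' e₂')
    (hT : ∀ n, ψ (tau e₁ e₂ n) ∈ (ofX e₁' e₂').range) :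
    ψ (Y e₁ e₂) ∉ (ofX e₁' e₂').range := by
  intro hY
  have hall : ∀ x, ψ x ∈ (ofX e₁' e₂').range := by
    intro x
    induction x using function_induction with
    | tau k => exact hT k
    | tau_mul_Y k => rw [map_mul]; exact mul_mem (hT k) hY
    | add x y hx hy => rw [map_add]; exact add_mem hx hy
    | smul c x hx =>
      rw [map_smul, Algebra.smul_def]
      exact mul_mem ⟨LaurentPolynomial.C c, rfl⟩ hx
  obtain ⟨p, hp⟩ := hall (ψ.symm (Y e₁' e₂'))
  rw [AlgEquiv.apply_symm_apply] at hp
  exact ofX_ne_Y _ _ p hp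

theorem mem_range_ofX_of_isUnit (hb : quadCoeff e₁ e₂ ≠ 0) {x : FunctionAlgebra e₁ e₂}
    (hx : IsUnit x) : x ∈ (ofX e₁ e₂).range := by
  obtain ⟨c, n, -, rfl⟩ := exists_eq_of_isUnit e₁ e₂ hb hx
  exact ⟨_, (algebraMap_mul_tau c n).symm⟩

/-- On the cuspidal cubic `Y² = 4 X³` the function `Y` is a unit outside the marked points, unlike
on a cubic for which `e₁` is a simple root. -/
theorem isEmpty_algEquiv_zero (hb : quadCoeff e₁' e₂' ≠ 0) :
    IsEmpty (FunctionAlgebra 0 0 ≃ₐ[ℂ] FunctionAlgebra e₁' e₂') := by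
  refine ⟨fun ψ => ?_⟩
  have hY : IsUnit (Y 0 0) := by
    have h1 : IsUnit (Y 0 0 ^ 2) := by
      have e : Y 0 0 ^ 2 = algebraMap ℂ (FunctionAlgebra 0 0) 4 * tau 0 0 1 ^ 3 := by
        rw [Y_sq_eq, map_ofNat]
        simp [quadCoeff]
      rw [e]
      exact ((IsUnit.mk0 (4 : ℂ) (by norm_num)).map _).mul ((isUnit_tau 1).pow 3)
    exact (isUnit_pow_iff two_ne_zero).1 h1
  exact not_mem_range_ofX ψ (fun n => mem_range_ofX_of_isUnit hb ((isUnit_tau n).map ψ))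
    (mem_range_ofX_of_isUnit hb (hY.map ψ))

theorem exists_algEquiv_tau (hb : quadCoeff e₁ e₂ ≠ 0) (hb' : quadCoeff e₁' e₂' ≠ 0)
    (ψ : FunctionAlgebra e₁ e₂ ≃ₐ[ℂ] FunctionAlgebra e₁' e₂') :
    ∃ (c : ℂ) (k : ℤ), c ≠ 0 ∧ (k = 1 ∨ k = -1) ∧
      ψ (tau e₁ e₂ 1) = algebraMap ℂ _ c * tau e₁' e₂' k := by
  obtain ⟨c, k, hc, h⟩ := exists_eq_of_isUnit e₁' e₂' hb'
    ((isUnit_tau (e₁ := e₁) (e₂ := e₂) 1).map ψ)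
  obtain ⟨d, j, hd, h'⟩ :=
    exists_eq_of_isUnit e₁ e₂ hb ((isUnit_tau (e₁ := e₁') (e₂ := e₂') 1).map ψ.symm)
  refine ⟨c, k, hc, ?_, h⟩
  have e := congrArg ψ h'
  rw [AlgEquiv.apply_symm_apply, map_mul, AlgEquiv.commutes, algEquiv_tau ψ hc h, ← mul_assoc,
    ← map_mul, algebraMap_mul_tau] at e
  have e' := congrArg (fun p => p.coeff 1) (ofX_injective _ _ e)
  simp only [← LaurentPolynomial.smul_eq_C_mul, AddMonoidAlgebra.coeff_smul, Finsupp.smul_apply,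
    LaurentPolynomial.T_apply, if_true] at e'
  have hkj : k * j = 1 := by
    by_contra hne
    simp [hne] at e'
  exact Int.eq_one_or_neg_one_of_mul_eq_one hkj

theorem exists_algEquiv_Y (hb' : quadCoeff e₁' e₂' ≠ 0)
    (ψ : FunctionAlgebra e₁ e₂ ≃ₐ[ℂ] FunctionAlgebra e₁' e₂') :
    ∃ q, ψ (Y e₁ e₂) = ofX e₁' e₂' q * Y e₁' e₂' := by
  have hT : ∀ n, ψ (tau e₁ e₂ n) ∈ (ofX e₁' e₂').range :=
    fun n => mem_range_ofX_of_isUnit hb' ((isUnit_tau n).map ψ)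
  obtain ⟨p, q, hpq⟩ := QuadraticExtension.exists_eq_add_mul_root (ψ (Y e₁ e₂))
  have hsq : ψ (Y e₁ e₂) ^ 2 ∈ (ofX e₁' e₂').range := by
    have hC : ∀ c : ℂ, algebraMap ℂ (FunctionAlgebra e₁' e₂') c ∈ (ofX e₁' e₂').range :=
      fun c => ⟨LaurentPolynomial.C c, rfl⟩
    rw [← map_pow, Y_sq_eq]
    simp only [map_mul ψ, map_add ψ, map_pow ψ, AlgEquiv.commutes]
    rw [map_ofNat, ← map_ofNat (algebraMap ℂ (FunctionAlgebra e₁' e₂'))]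
    exact mul_mem (hC _) (add_mem (add_mem (pow_mem (hT 1) 3)
      (mul_mem (hC _) (pow_mem (hT 1) 2))) (mul_mem (hC _) (hT 1)))
  obtain ⟨F, hF⟩ := hsq
  have e : ofX e₁' e₂' (p ^ 2 + q ^ 2 * cubic e₁' e₂') + ofX e₁' e₂' (2 * p * q) * Y e₁' e₂' =
      ofX e₁' e₂' F + ofX e₁' e₂' 0 * Y e₁' e₂' := by
    rw [hF, hpq]
    simp only [map_add (ofX e₁' e₂'), map_mul (ofX e₁' e₂'), map_pow (ofX e₁' e₂')]
    rw [← Y_sq, map_zero, map_ofNat]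
    ring
  have h0 := (QuadraticExtension.ext_iff.1 e).2
  rcases mul_eq_zero.1 h0 with h | h
  · have : CharZero ℂ[T;T⁻¹] := charZero_of_injective_algebraMap (algebraMap ℂ _).injective
    have hp : p = 0 := (mul_eq_zero.1 h).resolve_left two_ne_zero
    exact ⟨q, by rw [hpq, hp, map_zero, zero_add]⟩
  · exact absurd ⟨p, by rw [hpq, h, map_zero, zero_mul, add_zero]⟩ (not_mem_range_ofX ψ hT)

/-- An isomorphism of function algebras is `X - e₁ ↦ c (X' - e₁')^{±1}`, `Y ↦ d (X' - e₁')^m Y'`,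
and comparing the equations of the two curves gives the invariance of `e₁² / quadCoeff`. -/
theorem sq_mul_quadCoeff_eq (hb : quadCoeff e₁ e₂ ≠ 0) (hb' : quadCoeff e₁' e₂' ≠ 0)
    (ψ : FunctionAlgebra e₁ e₂ ≃ₐ[ℂ] FunctionAlgebra e₁' e₂') :
    e₁ ^ 2 * quadCoeff e₁' e₂' = e₁' ^ 2 * quadCoeff e₁ e₂ := by
  obtain ⟨c, k, hc, hk, hT⟩ := exists_algEquiv_tau hb hb' ψ
  obtain ⟨q, hq⟩ := exists_algEquiv_Y hb' ψ
  obtain ⟨r, hr⟩ := exists_algEquiv_Y hb ψ.symm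
  have hu : IsUnit (ofX e₁' e₂' q) := by
    refine IsUnit.of_mul_eq_one (ψ (ofX e₁ e₂ r)) ?_
    have e := congrArg ψ hr
    rw [AlgEquiv.apply_symm_apply, map_mul, hq] at e
    refine mul_right_cancel₀ (Y_ne_zero e₁' e₂') ?_
    linear_combination -e
  obtain ⟨d, m, hd, hdm⟩ := exists_eq_of_isUnit e₁' e₂' hb' hu
  have e : ψ (Y e₁ e₂) ^ 2 = 4 * (algebraMap ℂ _ (c ^ 3) * tau e₁' e₂' (k * 3) +
      algebraMap ℂ _ (3 * e₁ * c ^ 2) * tau e₁' e₂' (k * 2) +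
      algebraMap ℂ _ (quadCoeff e₁ e₂ * c) * tau e₁' e₂' k) := by
    rw [← map_pow, Y_sq_eq, tau_one_pow, tau_one_pow]
    simp only [map_mul ψ, map_add ψ, AlgEquiv.commutes, algEquiv_tau ψ hc hT, map_ofNat ψ,
      map_mul (algebraMap ℂ (FunctionAlgebra e₁' e₂'))]
    simp only [mul_one, zpow_one, mul_assoc]
    rfl
  have e' : algebraMap ℂ _ (d ^ 2) * tau e₁' e₂' (2 * m + 3) +
      algebraMap ℂ _ (3 * e₁' * d ^ 2) * tau e₁' e₂' (2 * m + 2) +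
      algebraMap ℂ _ (quadCoeff e₁' e₂' * d ^ 2) * tau e₁' e₂' (2 * m + 1) =
      algebraMap ℂ _ (c ^ 3) * tau e₁' e₂' (k * 3) +
      algebraMap ℂ _ (3 * e₁ * c ^ 2) * tau e₁' e₂' (k * 2) +
      algebraMap ℂ _ (quadCoeff e₁ e₂ * c) * tau e₁' e₂' k := by
    rw [hq, hdm, mul_pow, Y_sq_eq, mul_left_comm] at e
    have h4 : (4 : FunctionAlgebra e₁' e₂') ≠ 0 := by norm_num
    rw [← mul_left_cancel₀ h4 e, show 2 * m + 3 = m + m + (3 : ℕ) by push_cast; ring,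
      show 2 * m + 2 = m + m + (2 : ℕ) by push_cast; ring, two_mul]
    simp only [tau_add, ← tau_one_pow, map_mul, map_pow]
    ring
  simp only [algebraMap_mul_tau, ← map_add] at e'
  have key : ∀ n : ℤ, (d ^ 2 * (if 2 * m + 3 = n then 1 else 0) +
      3 * e₁' * d ^ 2 * (if 2 * m + 2 = n then 1 else 0) +
      quadCoeff e₁' e₂' * d ^ 2 * (if 2 * m + 1 = n then 1 else 0) : ℂ) =
      c ^ 3 * (if k * 3 = n then 1 else 0) +
      3 * e₁ * c ^ 2 * (if k * 2 = n then 1 else 0) +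
      quadCoeff e₁ e₂ * c * (if k = n then 1 else 0) := by
    intro n
    have := congrArg (fun p => p.coeff n) (ofX_injective _ _ e')
    simpa only [← LaurentPolynomial.smul_eq_C_mul, AddMonoidAlgebra.coeff_smul,
      AddMonoidAlgebra.coeff_add, Finsupp.add_apply, Finsupp.smul_apply, smul_eq_mul,
      LaurentPolynomial.T_apply] using this
  have hd2 : d ^ 2 ≠ 0 := pow_ne_zero 2 hd
  -- The outer coefficients on the left do not vanish, which determines the exponent `m`.
  have hm1 : 2 * m + 3 = k * 3 ∨ 2 * m + 3 = k * 2 ∨ 2 * m + 3 = k := by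
    by_contra! hcon
    have := key (2 * m + 3)
    rw [if_neg hcon.1.symm, if_neg hcon.2.1.symm, if_neg hcon.2.2.symm, if_pos rfl,
      if_neg (by omega), if_neg (by omega)] at this
    exact hd2 (by simpa using this)
  have hm2 : 2 * m + 1 = k * 3 ∨ 2 * m + 1 = k * 2 ∨ 2 * m + 1 = k := by
    by_contra! hcon
    have := key (2 * m + 1)
    rw [if_neg hcon.1.symm, if_neg hcon.2.1.symm, if_neg hcon.2.2.symm, if_pos rfl,
      if_neg (by omega), if_neg (by omega)] at this
    exact mul_ne_zero hb' hd2 (by simpa using this)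
  rcases hk with rfl | rfl
  · obtain rfl : m = 0 := by omega
    have k1 := key 1
    have k2 := key 2
    have k3 := key 3
    norm_num at k1 k2 k3
    refine mul_left_cancel₀ (pow_ne_zero 4 hc) ?_
    linear_combination -(quadCoeff e₁' e₂' / 3 * (e₁' * d ^ 2 + e₁ * c ^ 2)) * k2 +
      e₁' ^ 2 * d ^ 2 * k1 + e₁' ^ 2 * quadCoeff e₁ e₂ * c * k3
  · obtain rfl : m = -2 := by omega
    have k1 := key (-1)
    have k2 := key (-2)
    have k3 := key (-3)
    norm_num at k1 k2 k3
    refine mul_left_cancel₀ (pow_ne_zero 4 hc) ?_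
    linear_combination -(quadCoeff e₁' e₂' / 3 * (e₁' * d ^ 2 + e₁ * c ^ 2)) * k2 +
      e₁' ^ 2 * d ^ 2 * k3 + e₁' ^ 2 * c ^ 3 * k1

end PuncturedCurve

open PuncturedCurve in
/-- Along the curve `e₂ = 2 e₁²` the quotient `quadCoeff / e₁²` is `2 (1 - 2 t) (1 + t)`, which is
injective near `t = 0`. -/
theorem isEmpty_lieEquiv_of_norm_lt {s t : ℂ} (hs : ‖s‖ < 1 / 8) (ht : ‖t‖ < 1 / 8)
    (hst : s ≠ t) : IsEmpty (KNAlgebra s (2 * s ^ 2) ≃ₗ⁅ℂ⁆ KNAlgebra t (2 * t ^ 2)) := by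
  have hb : ∀ c : ℂ, ‖c‖ < 1 / 8 → c ≠ 0 → quadCoeff c (2 * c ^ 2) ≠ 0 := by
    intro c hc h0
    have e : quadCoeff c (2 * c ^ 2) = 2 * c ^ 2 * (1 - 2 * c) * (1 + c) := by
      rw [quadCoeff]; ring
    have h1 : 1 - 2 * c ≠ 0 := by
      intro h
      have : c = 1 / 2 := by linear_combination -h / 2
      rw [this] at hc; norm_num at hc
    have h2 : 1 + c ≠ 0 := by
      intro h
      have : c = -1 := by linear_combination h
      rw [this] at hc; norm_num at hc
    rw [e]
    simp [h0, h1, h2]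
  have hz : ∀ c : ℂ, ‖c‖ < 1 / 8 → c ≠ 0 →
      IsEmpty (FunctionAlgebra 0 (2 * 0 ^ 2) ≃ₐ[ℂ] FunctionAlgebra c (2 * c ^ 2)) := by
    intro c hc h0
    have := isEmpty_algEquiv_zero (hb c hc h0)
    rwa [show (2 * 0 ^ 2 : ℂ) = 0 by norm_num]
  refine ⟨fun φ => ?_⟩
  obtain ⟨ψ⟩ := nonempty_algEquiv_of_lieEquiv φ
  by_cases hs0 : s = 0
  · subst hs0
    exact (hz t ht (Ne.symm hst)).false ψ
  by_cases ht0 : t = 0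
  · subst ht0
    exact (hz s hs hs0).false ψ.symm
  have h := sq_mul_quadCoeff_eq (hb s hs hs0) (hb t ht ht0) ψ
  simp only [quadCoeff] at h
  have h' : (4 * s ^ 2 * t ^ 2 * (s - t)) * (1 / 2 + s + t) = 0 := by linear_combination h
  rcases mul_eq_zero.1 h' with h1 | h1
  · simp [hs0, ht0, sub_eq_zero, hst] at h1
  · have h2 : ‖s + t‖ = 1 / 2 := by
      rw [show s + t = -(1 / 2) by linear_combination h1]; norm_num
    have := norm_add_le s t
    linarith

/-! ### Vector fields on the punctured elliptic curve -/

namespace PuncturedCurve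

variable {e₁ e₂ : ℂ}

theorem derivation_ext {δ δ' : VectorFields e₁ e₂} (hT : δ (tau e₁ e₂ 1) = δ' (tau e₁ e₂ 1))
    (hY : δ (Y e₁ e₂) = δ' (Y e₁ e₂)) : δ = δ' := by
  have h : ∀ n, δ (tau e₁ e₂ n) = δ' (tau e₁ e₂ n) := by
    intro n
    induction n with
    | zero => simp
    | succ n ih => rw [tau_add, Derivation.leibniz, Derivation.leibniz, ih, hT]
    | pred n ih =>
      rw [tau_eq_sub_one_mul, Derivation.leibniz, Derivation.leibniz, hT] at ih
      exact mul_left_cancel₀ (tau_ne_zero e₁ e₂ 1) (add_left_cancel ih)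
  ext x
  induction x using function_induction with
  | tau k => exact h k
  | tau_mul_Y k => rw [Derivation.leibniz, Derivation.leibniz, h, hY]
  | add x y hx hy => rw [map_add, map_add, hx, hy]
  | smul c x hx => rw [Derivation.map_smul, Derivation.map_smul, hx]

theorem Y_mul_derivation_Y (δ : VectorFields e₁ e₂) :
    Y e₁ e₂ * δ (Y e₁ e₂) = halfDeriv e₁ e₂ * δ (tau e₁ e₂ 1) := by
  have h := congrArg δ (Y_sq_eq e₁ e₂)
  have h4 : δ (4 : FunctionAlgebra e₁ e₂) = 0 := by simpa using δ.map_natCast 4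
  simp only [pow_succ, pow_zero, one_mul, Derivation.leibniz, map_add, Derivation.map_algebraMap,
    h4, smul_eq_mul, mul_zero, add_zero] at h
  refine mul_left_cancel₀ (two_ne_zero (α := FunctionAlgebra e₁ e₂)) ?_
  rw [halfDeriv]
  linear_combination h

/-- If the two roots of the cubic other than `e₁` are distinct, then every vector field is a
multiple of `Y d/dX`: the function `X - e₁` is invertible, and `(e₁ + 2 e₂)²` is the discriminant of
the remaining quadratic factor. -/
theorem exists_eq_smul_invariantField (h : e₁ + 2 * e₂ ≠ 0) (δ : VectorFields e₁ e₂) :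
    ∃ a : FunctionAlgebra e₁ e₂, δ = a • invariantField e₁ e₂ := by
  have hYδ := Y_mul_derivation_Y δ
  have hY := Y_sq_eq e₁ e₂
  set x := tau e₁ e₂ 1 with hx
  set z := tau e₁ e₂ (-1) with hz
  have hxz : x * z = 1 := by rw [hx, hz, ← tau_add]; simp
  set E := algebraMap ℂ (FunctionAlgebra e₁ e₂) (3 * e₁) with hE
  set B := algebraMap ℂ (FunctionAlgebra e₁ e₂) (quadCoeff e₁ e₂) with hB
  set K := algebraMap ℂ (FunctionAlgebra e₁ e₂) ((e₁ + 2 * e₂) ^ 2)⁻¹ with hK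
  set c := algebraMap ℂ (FunctionAlgebra e₁ e₂) (1 / 2) with hc
  have hc2 : c * 2 = 1 := by
    rw [hc, ← map_ofNat (algebraMap ℂ (FunctionAlgebra e₁ e₂)) 2, ← map_mul]; norm_num
  have hKE : K * (E ^ 2 - 4 * B) = 1 := by
    rw [hK, hE, hB, ← map_ofNat (algebraMap ℂ (FunctionAlgebra e₁ e₂)) 4, ← map_pow, ← map_mul,
      ← map_sub, ← map_mul, ← map_one (algebraMap ℂ (FunctionAlgebra e₁ e₂))]
    congr 1
    rw [show (3 * e₁) ^ 2 - 4 * quadCoeff e₁ e₂ = (e₁ + 2 * e₂) ^ 2 by rw [quadCoeff]; ring]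
    exact inv_mul_cancel₀ (pow_ne_zero 2 h)
  -- With `g = x² + E x + B` the discriminant is `(2 x + E)² - 4 g`, and both `4 g = Y² / x` and
  -- `(2 x + E) δ x` are multiples of `Y`; multiplying `δ x` by it gives the quotient.
  obtain ⟨a, ha⟩ : ∃ a, δ x = a * Y e₁ e₂ := by
    refine ⟨K * ((2 * x + E) * z * c * (δ (Y e₁ e₂) - c * Y e₁ e₂ * z * δ x) -
      Y e₁ e₂ * z * δ x), ?_⟩
    rw [halfDeriv, ← hx, ← hE, ← hB] at hYδ
    generalize δ x = d at *
    generalize δ (Y e₁ e₂) = d' at *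
    generalize Y e₁ e₂ = y at *
    have e : (2 * x + E) * z * c * (y * d' - c * y ^ 2 * z * d) - y ^ 2 * z * d =
        (E ^ 2 - 4 * B) * d := by
      linear_combination (2 * x + E) * z * c * hYδ -
        ((2 * x + E) * z * c ^ 2 * z * d + z * d) * hY +
        (-4 * c ^ 2 * (2 * x + E) * z * (x ^ 2 + E * x + B) * d - 4 * (x ^ 2 + E * x + B) * d +
          (2 * x + E) ^ 2 * d) * hxz +
        (-2 * (2 * x + E) * z * c * (x ^ 2 + E * x + B) * d + (2 * x + E) ^ 2 * d * x * z) * hc2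
    linear_combination -d * hKE - K * e
  refine ⟨a, derivation_ext ?_ ?_⟩
  · rw [Derivation.smul_apply, invariantField_tau, ← hx, ha]
    simp
  · rw [Derivation.smul_apply, invariantField_Y, smul_eq_mul]
    refine mul_left_cancel₀ (Y_ne_zero e₁ e₂) ?_
    rw [hYδ, ha]; ring

/-- The vector field `g Y d/dX` with `g` corresponding to the given element. -/
noncomputable def toVectorField (e₁ e₂ : ℂ) : KNAlgebra e₁ e₂ →ₗ⁅ℂ⁆ VectorFields e₁ e₂ where
  toLinearMap := (LinearMap.toSpanSingleton (FunctionAlgebra e₁ e₂) (VectorFields e₁ e₂)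
    (invariantField e₁ e₂)).restrictScalars ℂ ∘ₗ (toFunction e₁ e₂).toLinearMap
  map_lie' {x y} := by
    ext g
    change toFunction e₁ e₂ ⁅x, y⁆ * invariantField e₁ e₂ g = toFunction e₁ e₂ x *
      invariantField e₁ e₂ (toFunction e₁ e₂ y * invariantField e₁ e₂ g) - toFunction e₁ e₂ y *
      invariantField e₁ e₂ (toFunction e₁ e₂ x * invariantField e₁ e₂ g)
    rw [toFunction_lie]
    simp only [wronskian, Derivation.leibniz, smul_eq_mul]
    ring

theorem toVectorField_apply (x : KNAlgebra e₁ e₂) (g : FunctionAlgebra e₁ e₂) :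
    toVectorField e₁ e₂ x g = toFunction e₁ e₂ x * invariantField e₁ e₂ g := rfl

theorem invariantField_xCoord :
    invariantField e₁ e₂ (ofX e₁ e₂ (xCoord e₁)) = Y e₁ e₂ := by
  have e : ofX e₁ e₂ (xCoord e₁) = tau e₁ e₂ 1 + algebraMap ℂ _ e₁ := by
    rw [xCoord, map_add, ofX_C]; rfl
  rw [e, map_add, Derivation.map_algebraMap, invariantField_tau]
  simp

theorem toVectorField_bijective (h : e₁ + 2 * e₂ ≠ 0) :
    Function.Bijective (toVectorField e₁ e₂) := by
  constructor
  · refine (injective_iff_map_eq_zero _).2 fun x hx => ?_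
    have e := toVectorField_apply x (ofX e₁ e₂ (xCoord e₁))
    rw [hx, invariantField_xCoord, Derivation.zero_apply] at e
    have := (mul_eq_zero.1 e.symm).resolve_right (Y_ne_zero e₁ e₂)
    simpa using this
  · intro δ
    obtain ⟨a, rfl⟩ := exists_eq_smul_invariantField h δ
    refine ⟨(toFunction e₁ e₂).symm a, ?_⟩
    ext g
    rw [toVectorField_apply, LinearEquiv.apply_symm_apply]
    rfl

theorem toVectorField_V_odd (k : ℤ) :
    toVectorField e₁ e₂ (KNAlgebra.V e₁ e₂ (2 * k + 1)) (ofX e₁ e₂ (xCoord e₁)) =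
      ofX e₁ e₂ (LaurentPolynomial.T k) * Y e₁ e₂ := by
  rw [toVectorField_apply, toFunction_V, vectorFieldBasis_odd, invariantField_xCoord]
  rfl

theorem toVectorField_V_even (k : ℤ) :
    toVectorField e₁ e₂ (KNAlgebra.V e₁ e₂ (2 * k)) (ofX e₁ e₂ (xCoord e₁)) =
      ofX e₁ e₂ (LaurentPolynomial.C (1 / 2) * cubic e₁ e₂ * LaurentPolynomial.T (k - 2)) := by
  rw [toVectorField_apply, toFunction_V, vectorFieldBasis_even, invariantField_xCoord]
  simp only [map_mul (ofX e₁ e₂)]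
  rw [← Y_sq, ofX_C, Algebra.smul_def]
  change _ = _ * _ * tau e₁ e₂ (k - 2)
  ring

end PuncturedCurve

/-! ### The fibres of the deformation -/

section Fibres

open Polynomial

theorem curveDeformation_br_l (n m : ℤ) :
    curveDeformation.br (1 ⊗ₜ WittAlgebra.l n) (1 ⊗ₜ WittAlgebra.l m) =
      familyEquiv.symm (knBasisBracket X (2 * X ^ 2) n m) := by
  change familyBracket X (2 * X ^ 2) _ _ = _
  rw [familyBracket_apply, ← familyEquiv_symm_single, ← familyEquiv_symm_single,
    LinearEquiv.apply_symm_apply, LinearEquiv.apply_symm_apply, bilinExtend_single, one_smul,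
    one_smul]

theorem familyEquiv_symm_smul_single (a : ℂ[X]) (i : ℤ) :
    familyEquiv.symm (a • Finsupp.single i 1) = a ⊗ₜ WittAlgebra.l i := by
  rw [Finsupp.smul_single, smul_eq_mul, mul_one, familyEquiv_symm_single]

theorem zsmul_tmul_l (k : ℤ) (a : ℂ[X]) (i : ℤ) :
    k • (a ⊗ₜ[ℂ] WittAlgebra.l i) = ((k : ℂ[X]) * a) ⊗ₜ[ℂ] WittAlgebra.l i := by
  rw [← Int.cast_smul_eq_zsmul ℂ[X], TensorProduct.smul_tmul', smul_eq_mul]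

theorem quadCoeff_X : ((X - 2 * X ^ 2) * (X - -(X + 2 * X ^ 2)) : ℂ[X]) =
    2 * X ^ 2 * (1 - 2 * X) * (1 + X) := by ring

theorem curveDeformation_br_odd_odd {n m : ℤ} (hn : Odd n) (hm : Odd m) :
    curveDeformation.br (1 ⊗ₜ WittAlgebra.l n) (1 ⊗ₜ WittAlgebra.l m) =
      (m - n) • ((1 : ℂ[X]) ⊗ₜ WittAlgebra.l (n + m)) := by
  rw [curveDeformation_br_l]
  simp only [knBasisBracket, hn, hm, if_true, familyEquiv_symm_smul_single, zsmul_tmul_l, mul_one]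

theorem curveDeformation_br_even_even {n m : ℤ} (hn : Even n) (hm : Even m) :
    curveDeformation.br (1 ⊗ₜ WittAlgebra.l n) (1 ⊗ₜ WittAlgebra.l m) =
      (m - n) • (((1 : ℂ[X]) ⊗ₜ WittAlgebra.l (n + m))
        + ((3 * X : ℂ[X]) ⊗ₜ WittAlgebra.l (n + m - 2))
        + ((2 * X ^ 2 * (1 - 2 * X) * (1 + X) : ℂ[X]) ⊗ₜ WittAlgebra.l (n + m - 4))) := by
  rw [curveDeformation_br_l]
  simp only [knBasisBracket, Int.not_odd_iff_even.2 hn, Int.not_odd_iff_even.2 hm, if_false,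
    quadCoeff_X, smul_add, smul_smul, map_add, familyEquiv_symm_smul_single, zsmul_tmul_l,
    mul_one]

theorem curveDeformation_br_odd_even {n m : ℤ} (hn : Odd n) (hm : Even m) :
    curveDeformation.br (1 ⊗ₜ WittAlgebra.l n) (1 ⊗ₜ WittAlgebra.l m) =
      (m - n) • ((1 : ℂ[X]) ⊗ₜ WittAlgebra.l (n + m))
        + (m - n - 1) • ((3 * X : ℂ[X]) ⊗ₜ WittAlgebra.l (n + m - 2))
        + (m - n - 2) • ((2 * X ^ 2 * (1 - 2 * X) * (1 + X) : ℂ[X]) ⊗ₜ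
            WittAlgebra.l (n + m - 4)) := by
  rw [curveDeformation_br_l]
  simp only [knBasisBracket, hn, Int.not_odd_iff_even.2 hm, if_true, if_false,
    quadCoeff_X, map_add, familyEquiv_symm_smul_single, zsmul_tmul_l, mul_one]

theorem specialize_familyEquiv_symm (c : ℂ) (v : ℤ →₀ ℂ[X]) :
    specialize (aeval c) WittAlgebra (familyEquiv.symm v) =
      Finsupp.mapRange.addMonoidHom (aeval c : ℂ[X] →ₐ[ℂ] ℂ).toRingHom.toAddMonoidHom v := by
  induction v using Finsupp.induction_linear with
  | zero => simp only [map_zero]; rfl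
  | add f g hf hg => simp only [map_add, hf, hg]; rfl
  | single i a =>
    rw [familyEquiv_symm_single, specialize_tmul]
    simp only [Finsupp.mapRange.addMonoidHom_apply, Finsupp.mapRange_single]
    change (aeval c a • Finsupp.single i (1 : ℂ) : ℤ →₀ ℂ) = _
    simp

theorem mapRange_knBasisBracket {R S : Type*} [CommRing R] [CommRing S] (g : R →+* S) (e₁ e₂ : R)
    (n m : ℤ) : Finsupp.mapRange.addMonoidHom g.toAddMonoidHom (knBasisBracket e₁ e₂ n m) =
      knBasisBracket (g e₁) (g e₂) n m := by
  have h : ∀ (a : R) (v : ℤ →₀ R), Finsupp.mapRange.addMonoidHom g.toAddMonoidHom (a • v) =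
      g a • Finsupp.mapRange.addMonoidHom g.toAddMonoidHom v := by
    intro a v; ext i; simp
  have h' : ∀ i : ℤ, Finsupp.mapRange.addMonoidHom g.toAddMonoidHom (Finsupp.single i (1 : R)) =
      Finsupp.single i (1 : S) := by
    intro i; simp
  simp only [knBasisBracket]
  split_ifs <;> simp only [map_add, map_neg, h, h', map_mul, map_sub, map_intCast, map_ofNat]

theorem eq_bilinExtend {R : Type*} [CommRing R] {F : (ℤ →₀ R) →ₗ[R] (ℤ →₀ R) →ₗ[R] (ℤ →₀ R)}
    {b : ℤ → ℤ → (ℤ →₀ R)} (h : ∀ n m, F (Finsupp.single n 1) (Finsupp.single m 1) = b n m) :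
    F = bilinExtend b := by
  refine Finsupp.lhom_ext' fun n => LinearMap.ext_ring (Finsupp.lhom_ext' fun m =>
    LinearMap.ext_ring ?_)
  simp [h, bilinExtend_single]

theorem fibreBracket_curveDeformation (c : ℂ) (x y : ℤ →₀ ℂ) :
    curveDeformation.fibreBracket (aeval c) x y =
      bilinExtend (knBasisBracket c (2 * c ^ 2)) x y := by
  have h : ∀ n m : ℤ, curveDeformation.fibreBracket (aeval c) (WittAlgebra.l n) (WittAlgebra.l m) =
      knBasisBracket c (2 * c ^ 2) n m := by
    intro n m
    change specialize (aeval c) WittAlgebra (curveDeformation.br _ _) = _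
    rw [curveDeformation_br_l, specialize_familyEquiv_symm]
    refine (mapRange_knBasisBracket _ _ _ n m).trans ?_
    simp
  exact LinearMap.congr_fun₂ (eq_bilinExtend h) x y

/-- The fibre of the deformation at `c`. -/
noncomputable def fibreEquiv (c : ℂ) : curveDeformation.at c ≃ₗ⁅ℂ⁆ KNAlgebra c (2 * c ^ 2) where
  toFun x := x
  invFun x := x
  left_inv _ := rfl
  right_inv _ := rfl
  map_add' _ _ := rfl
  map_smul' _ _ := rfl
  map_lie' {x y} := fibreBracket_curveDeformation c x y

/-- The fibre of the deformation at `0` is the Witt algebra. -/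
noncomputable def fibreZeroEquiv : curveDeformation.at 0 ≃ₗ⁅ℂ⁆ WittAlgebra where
  toFun x := x
  invFun x := x
  left_inv _ := rfl
  right_inv _ := rfl
  map_add' _ _ := rfl
  map_smul' _ _ := rfl
  map_lie' {x y} := by
    have h := curveDeformation.specialize_br (1 ⊗ₜ x) (1 ⊗ₜ y)
    have hs : ∀ w : WittAlgebra, specialize (aeval (0 : ℂ)) WittAlgebra (1 ⊗ₜ w) = w := by
      intro w; rw [specialize_tmul, map_one, one_smul]
    exact h.trans (congrArg₂ (fun u v : WittAlgebra => ⁅u, v⁆) (hs x) (hs y))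

end Fibres

/-! ### The elliptic curves along `e₂ = 2 e₁²` -/

section EllipticCurves

theorem cubicCurve_Δ (c : ℂ) : (cubicCurve c (2 * c ^ 2)).Δ =
    64 * c ^ 6 * ((1 - 2 * c) * (1 + c) * (1 + 4 * c)) ^ 2 := by
  simp only [cubicCurve, WeierstrassCurve.Δ, WeierstrassCurve.b₂, WeierstrassCurve.b₄,
    WeierstrassCurve.b₆, WeierstrassCurve.b₈]
  ring

theorem cubicCurve_c₄ (c : ℂ) : (cubicCurve c (2 * c ^ 2)).c₄ =
    48 * c ^ 2 * (1 + 2 * c + 4 * c ^ 2) := by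
  simp only [cubicCurve, WeierstrassCurve.c₄, WeierstrassCurve.b₂, WeierstrassCurve.b₄]
  ring

theorem cubicCurve_c₆ (c : ℂ) : (cubicCurve c (2 * c ^ 2)).c₆ =
    -1728 * c ^ 4 * (1 + 2 * c) := by
  simp only [cubicCurve, WeierstrassCurve.c₆, WeierstrassCurve.b₂, WeierstrassCurve.b₄,
    WeierstrassCurve.b₆]
  ring

theorem cubicCurve_isElliptic_iff (c : ℂ) : (cubicCurve c (2 * c ^ 2)).IsElliptic ↔
    c ≠ 0 ∧ c ≠ 1 / 2 ∧ c ≠ -1 ∧ c ≠ -1 / 4 := by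
  rw [WeierstrassCurve.isElliptic_iff, isUnit_iff_ne_zero, cubicCurve_Δ]
  have h1 : 1 - 2 * c = 0 ↔ c = 1 / 2 :=
    ⟨fun h => by linear_combination -h / 2, fun h => by rw [h]; norm_num⟩
  have h2 : 1 + c = 0 ↔ c = -1 :=
    ⟨fun h => by linear_combination h, fun h => by rw [h]; norm_num⟩
  have h3 : 1 + 4 * c = 0 ↔ c = -1 / 4 :=
    ⟨fun h => by linear_combination h / 4, fun h => by rw [h]; norm_num⟩
  simp only [ne_eq, mul_eq_zero, pow_eq_zero_iff, OfNat.ofNat_ne_zero, not_false_eq_true, h1, h2,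
    h3, false_or, not_or, and_assoc]

theorem cubicCurve_j (c : ℂ) [h : (cubicCurve c (2 * c ^ 2)).IsElliptic] :
    (cubicCurve c (2 * c ^ 2)).j = jAlongCurve c := by
  have h0 := (cubicCurve c (2 * c ^ 2)).isUnit_Δ.ne_zero
  rw [WeierstrassCurve.j, Units.val_inv_eq_inv_val, WeierstrassCurve.coe_Δ', jAlongCurve]
  rw [cubicCurve_Δ] at h0 ⊢
  rw [cubicCurve_c₄]
  simp only [ne_eq, mul_eq_zero, pow_eq_zero_iff, OfNat.ofNat_ne_zero, not_false_eq_true,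
    false_or, not_or] at h0
  obtain ⟨h0, ⟨h1, h2⟩, h3⟩ := h0
  field_simp
  ring

/-- `1 + z` does not vanish for `‖z‖ < 1`. -/
theorem one_add_ne_zero_of_norm_lt_one {z : ℂ} (hz : ‖z‖ < 1) : 1 + z ≠ 0 := by
  intro h
  rw [show z = -1 by linear_combination h] at hz
  norm_num at hz

theorem norm_four_mul_mul_lt {s t : ℂ} (hs : ‖s‖ < 1 / 8) (ht : ‖t‖ < 1 / 8) :
    ‖4 * s * t‖ < 1 / 16 := by
  rw [norm_mul, norm_mul, Complex.norm_ofNat]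
  nlinarith [norm_nonneg s, norm_nonneg t]

theorem norm_two_mul_lt {s : ℂ} (hs : ‖s‖ < 1 / 8) : ‖2 * s‖ < 1 / 4 := by
  rw [norm_mul, Complex.norm_ofNat]
  linarith

theorem one_add_two_mul_add_ne_zero {s t : ℂ} (hs : ‖s‖ < 1 / 8) (ht : ‖t‖ < 1 / 8) :
    1 + 2 * (s + t) ≠ 0 := by
  refine one_add_ne_zero_of_norm_lt_one ?_
  rw [mul_add]
  linarith [norm_add_le (2 * s) (2 * t), norm_two_mul_lt hs, norm_two_mul_lt ht]

/-- With `σ = c (1 + 2 c)` one has `j - 1728 = 1728 · 27 σ² / ((1 - σ)² (1 + 8 σ))`. -/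
theorem jAlongCurve_ne_of_norm_lt {c : ℂ} (hc : c ≠ 0) (h : ‖c‖ < 1 / 8) :
    jAlongCurve c ≠ 1728 := by
  have h2 : 1 + 2 * c ≠ 0 :=
    one_add_ne_zero_of_norm_lt_one ((norm_two_mul_lt h).trans (by norm_num))
  intro hj
  rw [jAlongCurve, mul_eq_left₀ (by norm_num)] at hj
  have h3 := eq_of_div_eq_one hj
  have h4 : 27 * (c * (1 + 2 * c)) ^ 2 = 0 := by linear_combination h3
  simp [hc, h2] at h4

theorem jAlongCurve_not_eventually_const :
    ¬ ∃ k : ℂ, ∀ᶠ c in 𝓝[≠] (0 : ℂ), jAlongCurve c = k := by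
  rintro ⟨k, hk⟩
  have hcont : ContinuousAt jAlongCurve 0 := by
    unfold jAlongCurve
    refine ContinuousAt.mul continuousAt_const (ContinuousAt.div ?_ ?_ (by norm_num)) <;>
    fun_prop
  have hlim : Filter.Tendsto jAlongCurve (𝓝[≠] 0) (𝓝 1728) := by
    have := hcont.tendsto.mono_left (nhdsWithin_le_nhds (s := {0}ᶜ))
    simpa [jAlongCurve] using this
  have hk' : k = 1728 := tendsto_nhds_unique
    (tendsto_const_nhds.congr' (hk.mono fun _ h => h.symm)) hlim
  have hball : ∀ᶠ c in 𝓝[≠] (0 : ℂ), c ∈ Metric.ball (0 : ℂ) (1 / 8) :=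
    nhdsWithin_le_nhds (Metric.ball_mem_nhds 0 (by norm_num))
  obtain ⟨c, ⟨h1, h2⟩, h3⟩ := ((hk.and hball).and self_mem_nhdsWithin).exists
  exact jAlongCurve_ne_of_norm_lt h3 (by simpa using h2) (h1.trans hk')

theorem cubicCurve_isElliptic_of_norm_lt {s : ℂ} (h0 : 0 < ‖s‖) (h : ‖s‖ < 1 / 8) :
    (cubicCurve s (2 * s ^ 2)).IsElliptic := by
  rw [cubicCurve_isElliptic_iff]
  refine ⟨norm_pos_iff.1 h0, ?_, ?_, ?_⟩ <;>
  · rintro rfl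
    norm_num at h

theorem not_twoPointedIso {s t : ℂ} (hs0 : s ≠ 0) (hs : ‖s‖ < 1 / 8)
    (ht : ‖t‖ < 1 / 8) (hst : s ≠ t) : ¬ TwoPointedIso s (2 * s ^ 2) t (2 * t ^ 2) := by
  rintro ⟨C, hC, h1, -⟩
  have hu : (C.u : ℂ) ≠ 0 := C.u.ne_zero
  have e1 := congrArg WeierstrassCurve.a₁ hC
  have e2 := congrArg WeierstrassCurve.a₂ hC
  have e4 := congrArg WeierstrassCurve.c₄ hC
  rw [WeierstrassCurve.variableChange_c₄, cubicCurve_c₄, cubicCurve_c₄] at e4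
  simp [WeierstrassCurve.variableChange_a₁, cubicCurve] at e1
  simp [WeierstrassCurve.variableChange_a₂, cubicCurve, e1] at e2
  rw [e2, add_zero] at h1
  rw [Units.val_inv_eq_inv_val, inv_pow, inv_mul_eq_iff_eq_mul₀ (pow_ne_zero 4 hu)] at e4
  have e5 : (s ^ 2 * (s - t)) * (1 + 2 * (s + t)) = 0 := by
    linear_combination e4 / 96 + (1 + 2 * t + 4 * t ^ 2) / 2 * (C.u ^ 2 * t + s) * h1
  rcases mul_eq_zero.1 e5 with h | h
  · simp [hs0, sub_eq_zero, hst] at h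
  · exact one_add_two_mul_add_ne_zero hs ht h

theorem eq_or_eq_of_variableChange {s t : ℂ} (hs0 : s ≠ 0) (hs : ‖s‖ < 1 / 8) (ht0 : t ≠ 0)
    (ht : ‖t‖ < 1 / 8) {C : WeierstrassCurve.VariableChange ℂ}
    (hC : C • cubicCurve s (2 * s ^ 2) = cubicCurve t (2 * t ^ 2)) :
    t = s ∨ t = -s / (1 + 2 * s) := by
  have e4 := congrArg WeierstrassCurve.c₄ hC
  have e6 := congrArg WeierstrassCurve.c₆ hC
  rw [WeierstrassCurve.variableChange_c₄] at e4
  rw [WeierstrassCurve.variableChange_c₆] at e6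
  have e : (cubicCurve t (2 * t ^ 2)).c₄ ^ 3 * (cubicCurve s (2 * s ^ 2)).c₆ ^ 2 =
      (cubicCurve s (2 * s ^ 2)).c₄ ^ 3 * (cubicCurve t (2 * t ^ 2)).c₆ ^ 2 := by
    rw [← e4, ← e6]; ring
  rw [cubicCurve_c₄, cubicCurve_c₄, cubicCurve_c₆, cubicCurve_c₆] at e
  have e' : (48 ^ 3 * 1728 ^ 2 * s ^ 6 * t ^ 6) * ((s - t) * (1 + 2 * (s + t)) *
      (s + t * (1 + 2 * s)) * (1 + (2 * s + 4 * s * t)) * (1 + (2 * t + 4 * s * t)) *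
        (1 + -(4 * s * t))) = 0 := by
    linear_combination e
  have h1 := one_add_two_mul_add_ne_zero hs ht
  have h2 : 1 + (2 * s + 4 * s * t) ≠ 0 := one_add_ne_zero_of_norm_lt_one (by
    linarith [norm_add_le (2 * s) (4 * s * t), norm_two_mul_lt hs, norm_four_mul_mul_lt hs ht])
  have h3 : 1 + (2 * t + 4 * s * t) ≠ 0 := one_add_ne_zero_of_norm_lt_one (by
    linarith [norm_add_le (2 * t) (4 * s * t), norm_two_mul_lt ht, norm_four_mul_mul_lt hs ht])
  have h4 : 1 + -(4 * s * t) ≠ 0 := one_add_ne_zero_of_norm_lt_one (by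
    rw [norm_neg]; linarith [norm_four_mul_mul_lt hs ht])
  have h5 : 1 + 2 * s ≠ 0 := one_add_ne_zero_of_norm_lt_one (by linarith [norm_two_mul_lt hs])
  simp only [mul_eq_zero, h1, h2, h3, h4, hs0, ht0, pow_eq_zero_iff, OfNat.ofNat_ne_zero, ne_eq,
    not_false_eq_true, or_false, false_or] at e'
  rcases e' with h | h
  · exact Or.inl (sub_eq_zero.1 h).symm
  · exact Or.inr ((eq_div_iff h5).2 (by linear_combination h))

/-- The roots `e₁`, `e₃` at the parameter `-s / (1 + 2 s)` are those at `s`, exchanged and scaled by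
`(1 + 2 s)⁻²`. -/
theorem exists_variableChange {s : ℂ} (hs : 1 + 2 * s ≠ 0) :
    ∃ C : WeierstrassCurve.VariableChange ℂ, C • cubicCurve s (2 * s ^ 2) =
      cubicCurve (-s / (1 + 2 * s)) (2 * (-s / (1 + 2 * s)) ^ 2) := by
  refine ⟨⟨Units.mk0 (1 + 2 * s) hs, 0, 0, 0⟩, ?_⟩
  ext
  · simp [WeierstrassCurve.variableChange_a₁, cubicCurve]
  · simp [WeierstrassCurve.variableChange_a₂, cubicCurve]
  · simp [WeierstrassCurve.variableChange_a₃, cubicCurve]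
  · simp only [WeierstrassCurve.variableChange_a₄, cubicCurve, Units.val_inv_eq_inv_val,
      Units.val_mk0]
    field_simp
    ring
  · simp only [WeierstrassCurve.variableChange_a₆, cubicCurve, Units.val_inv_eq_inv_val,
      Units.val_mk0]
    field_simp
    ring

end EllipticCurves

theorem curveDeformation_not_isJump : ¬ curveDeformation.IsJump := by
  rintro ⟨U, hU, h⟩
  obtain ⟨r, hr, hrU⟩ := Metric.mem_nhds_iff.1 hU
  have hρ : 0 < min r (1 / 8) := lt_min hr (by norm_num)
  obtain ⟨ρ, hρ0, hρ1⟩ := exists_between hρ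
  have hmem : ∀ x : ℝ, 0 < x → x ≤ ρ → (x : ℂ) ∈ U ∧ (x : ℂ) ≠ 0 ∧ ‖(x : ℂ)‖ < 1 / 8 := by
    intro x hx hxρ
    have hn : ‖(x : ℂ)‖ = x := by rw [Complex.norm_real, Real.norm_of_nonneg hx.le]
    refine ⟨hrU ?_, by exact_mod_cast hx.ne', ?_⟩
    · rw [mem_ball_zero_iff, hn]
      exact hxρ.trans_lt (hρ1.trans_le (min_le_left _ _))
    · rw [hn]
      exact hxρ.trans_lt (hρ1.trans_le (min_le_right _ _))
  obtain ⟨s1, s2, s3⟩ := hmem ρ hρ0 le_rfl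
  obtain ⟨t1, t2, t3⟩ := hmem (ρ / 2) (by linarith) (by linarith)
  obtain ⟨φ⟩ := (h _ s1 s2).1 _ t1 t2
  refine (isEmpty_lieEquiv_of_norm_lt s3 t3 ?_).false
    (((fibreEquiv _).symm.trans φ).trans (fibreEquiv _))
  norm_cast
  linarith

/-! ### The classification along the curve -/

theorem mainTheorem2 :
    -- the explicit bracket of the deformation over `ℂ[t]`
    (∀ n m : ℤ, Odd n → Odd m →
      curveDeformation.br (1 ⊗ₜ WittAlgebra.l n) (1 ⊗ₜ WittAlgebra.l m) =
        (m - n) • ((1 : Polynomial ℂ) ⊗ₜ WittAlgebra.l (n + m))) ∧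
    (∀ n m : ℤ, Even n → Even m →
      curveDeformation.br (1 ⊗ₜ WittAlgebra.l n) (1 ⊗ₜ WittAlgebra.l m) =
        (m - n) • (((1 : Polynomial ℂ) ⊗ₜ WittAlgebra.l (n + m))
          + ((3 * Polynomial.X : Polynomial ℂ) ⊗ₜ WittAlgebra.l (n + m - 2))
          + ((2 * Polynomial.X ^ 2 * (1 - 2 * Polynomial.X) * (1 + Polynomial.X) :
              Polynomial ℂ) ⊗ₜ WittAlgebra.l (n + m - 4)))) ∧
    (∀ n m : ℤ, Odd n → Even m →
      curveDeformation.br (1 ⊗ₜ WittAlgebra.l n) (1 ⊗ₜ WittAlgebra.l m) =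
        (m - n) • ((1 : Polynomial ℂ) ⊗ₜ WittAlgebra.l (n + m))
          + (m - n - 1) • ((3 * Polynomial.X : Polynomial ℂ) ⊗ₜ WittAlgebra.l (n + m - 2))
          + (m - n - 2) • ((2 * Polynomial.X ^ 2 * (1 - 2 * Polynomial.X) * (1 + Polynomial.X) :
              Polynomial ℂ) ⊗ₜ WittAlgebra.l (n + m - 4))) ∧
    -- its fibres are the algebras of the two-parameter family along the curve
    (∀ c : ℂ, ∃ φ : curveDeformation.at c ≃ₗ⁅ℂ⁆ KNAlgebra c (2 * c ^ 2),
      ∀ n : ℤ, φ (curveDeformation.toFibre _ (WittAlgebra.l n)) = KNAlgebra.V c (2 * c ^ 2) n) ∧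
    Nonempty (curveDeformation.at 0 ≃ₗ⁅ℂ⁆ WittAlgebra) ∧
    -- over smooth cubics they are the vector field algebras, with
    -- `V_{2k+1} = (X - e₁)^k Y d/dX` and `V_{2k} = (1/2) f(X) (X - e₁)^{k-2} d/dX`
    (∀ c : ℂ, (cubicCurve c (2 * c ^ 2)).IsElliptic →
      ∃ φ : KNAlgebra c (2 * c ^ 2) ≃ₗ⁅ℂ⁆ PuncturedCurve.VectorFields c (2 * c ^ 2),
        ∀ k : ℤ,
          φ (KNAlgebra.V c (2 * c ^ 2) (2 * k + 1))
              (PuncturedCurve.ofX c (2 * c ^ 2) (PuncturedCurve.xCoord c)) =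
            PuncturedCurve.ofX c (2 * c ^ 2) (LaurentPolynomial.T k) *
              PuncturedCurve.Y c (2 * c ^ 2) ∧
          φ (KNAlgebra.V c (2 * c ^ 2) (2 * k))
              (PuncturedCurve.ofX c (2 * c ^ 2) (PuncturedCurve.xCoord c)) =
            PuncturedCurve.ofX c (2 * c ^ 2) (LaurentPolynomial.C (1 / 2) *
              PuncturedCurve.cubic c (2 * c ^ 2) * LaurentPolynomial.T (k - 2))) ∧
    -- the elliptic curves and their `j`-invariants along the curve
    (∀ c : ℂ, (cubicCurve c (2 * c ^ 2)).IsElliptic ↔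
      c ≠ 0 ∧ c ≠ 1 / 2 ∧ c ≠ -1 ∧ c ≠ -1 / 4) ∧
    (∀ (c : ℂ) [(cubicCurve c (2 * c ^ 2)).IsElliptic],
      (cubicCurve c (2 * c ^ 2)).j = jAlongCurve c) ∧
    (¬ ∃ k : ℂ, ∀ᶠ c in 𝓝[≠] (0 : ℂ), jAlongCurve c = k) ∧
    -- classification near `0`
    (∃ ε : ℝ, 0 < ε ∧
      (∀ s : ℂ, 0 < ‖s‖ → ‖s‖ < ε → (cubicCurve s (2 * s ^ 2)).IsElliptic) ∧
      (∀ s t : ℂ, 0 < ‖s‖ → ‖s‖ < ε → 0 < ‖t‖ → ‖t‖ < ε → s ≠ t →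
        ¬ TwoPointedIso s (2 * s ^ 2) t (2 * t ^ 2)) ∧
      (∀ s t : ℂ, 0 < ‖s‖ → ‖s‖ < ε → 0 < ‖t‖ → ‖t‖ < ε →
        ((∃ C : WeierstrassCurve.VariableChange ℂ,
            C • cubicCurve s (2 * s ^ 2) = cubicCurve t (2 * t ^ 2)) ↔
          t = s ∨ t = -s / (1 + 2 * s))) ∧
      (∀ s t : ℂ, ‖s‖ < ε → ‖t‖ < ε → s ≠ t →
        IsEmpty (KNAlgebra s (2 * s ^ 2) ≃ₗ⁅ℂ⁆ KNAlgebra t (2 * t ^ 2)))) ∧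
    ¬ curveDeformation.IsJump := by
  refine ⟨fun n m => curveDeformation_br_odd_odd, fun n m => curveDeformation_br_even_even,
    fun n m => curveDeformation_br_odd_even, fun c => ⟨fibreEquiv c, fun n => rfl⟩,
    ⟨fibreZeroEquiv⟩, fun c hc => ?_, cubicCurve_isElliptic_iff, fun c hc => cubicCurve_j c,
    jAlongCurve_not_eventually_const, ⟨1 / 8, by norm_num,
      fun s => cubicCurve_isElliptic_of_norm_lt,
      fun s t hs0 hs ht0 ht hst => not_twoPointedIso (norm_pos_iff.1 hs0) hs ht hst,
      fun s t hs0 hs ht0 ht => ⟨?_, ?_⟩,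
      fun s t hs ht hst => isEmpty_lieEquiv_of_norm_lt hs ht hst⟩,
    curveDeformation_not_isJump⟩
  · obtain ⟨h0, -, -, h3⟩ := (cubicCurve_isElliptic_iff c).1 hc
    have h : c + 2 * (2 * c ^ 2) ≠ 0 := by
      intro h
      rcases mul_eq_zero.1 (show c * (1 + 4 * c) = 0 by linear_combination h) with h' | h'
      · exact h0 h'
      · exact h3 (by linear_combination h' / 4)
    refine ⟨LieEquiv.ofBijective (PuncturedCurve.toVectorField c (2 * c ^ 2))
      (PuncturedCurve.toVectorField_bijective h), fun k =>
      ⟨PuncturedCurve.toVectorField_V_odd k, PuncturedCurve.toVectorField_V_even k⟩⟩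
  · rintro ⟨C, hC⟩
    exact eq_or_eq_of_variableChange (norm_pos_iff.1 hs0) hs (norm_pos_iff.1 ht0) ht hC
  · rintro (rfl | rfl)
    · exact ⟨1, one_smul _ _⟩
    · exact exists_variableChange
        (one_add_ne_zero_of_norm_lt_one ((norm_two_mul_lt hs).trans (by norm_num)))
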